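/- **Notation.** Let $s,n\ge 1$ be integers. For a commutative ring $R$, consider truncated series $f=\sum_{1\le |w|\le n} f_w z_w$ with coefficients $f_w\in R$ indexed by the words $w$ over the alphabet $\{1,\dots,s\}$ of length $1\le|w|\le n$. Their boxed convolution is $$(f\boxtimes g)_w=\sum_{\pi\in \mathrm{NC}(|w|)}\ \prod_{V\in\pi} f_{w|V}\ \prod_{V\in K(\pi)} g_{w|V},$$ where $\mathrm{NC}(m)$ is the set of non-crossing partitions of $\{1,\dots,m\}$, $w|V$ is the subword of $w$ at the positions in $V$, and $K(\pi)$ is the Kreweras complement of $\pi$: the largest partition $\sigma$ of $\{\bar 1,\dots,\bar m\}$ such that $\pi\cup\sigma$ is a non-crossing partition of $1<\bar1<2<\bar 2<\dots<m<\bar m$. Let $(\mathfrak G^s)_n(R)$ be the set of those $f$ for which $f_{(1)},\dots,f_{(s)}$ are units of $R$, and $(\mathfrak G^s_+)_n(R)$ the set of those $f$ for which $f_{(1)}=\dots=f_{(s)}=1$. Let $\mathbb B_N(R)\subseteq \mathrm{GL}_N(R)$ be the group of invertible upper-triangular matrices, $\mathbb U_N(R)$ its subgroup of matrices with all diagonal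 entries $1$, and $\mathbb T_N(R)$ the group of invertible diagonal matrices. For a field $k$, a closed subgroup of $\mathrm{GL}_N$ over $k$ is a family of subgroups $H(R)\le \mathrm{GL}_N(R)$, for all commutative $k$-algebras $R$, which is cut out, for all $R$ simultaneously, by one set of polynomial equations in the matrix entries with coefficients in $k$. **Theorem.** For all integers $s,n\ge1$ there is a positive integer $N=N(n,s)$ such that for every field $k$ the following hold. 1. There are a closed subgroup $H$ of $\mathrm{GL}_N$ over $k$ with $H(R)\subseteq\mathbb B_N(R)$ for all $R$ and bijections $\rho_R:(\mathfrak G^s)_n(R)\to H(R)$, natural in the commutative $k$-algebra $R$, with $\rho_R(f\boxtimes g)=\rho_R(f)\rho_R(g)$. In particular (for $R=k$) the group $((\mathfrak G^s)_n(k),\boxtimes)$ has a faithful representation of dimension $N$ as a closed subgroup of $\mathbb B_N(k)$. 2. In the same sense, $((\mathfrak G^s_+)_n,\boxtimes)$ has a faithful representation, natural in $R$, as a closed subgroup of $\mathbb U_N$ over $k$. 3. There are isomorphisms $((\mathfrak G^s)_1(R),\boxtimes)\cong\mathbb T_s(R)$, natural in the commutative $k$-algebra $R$; in particular $((\mathfrak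 G^s)_1(k),\boxtimes)\cong \mathbb T_s(k)$. -/

import Mathlib

open scoped MatrixGroups

/-! ## Non-crossing partitions and the Kreweras complement -/

/-- Partitions of `[n]`; `π ≤ σ` means that every block of `π` lies in a block of `σ`. -/
abbrev SetPartition (n : ℕ) : Type := Finpartition (Finset.univ : Finset (Fin n))

namespace SetPartition

variable {n : ℕ}

/-- `i ∼_π j`: the elements `i` and `j` lie in the same block of `π`. -/
def Rel (π : SetPartition n) (i j : Fin n) : Prop := π.part i = π.part j

/-- An equivalence relation on a totally ordered set is non-crossing if there are no
`p₁ < q₁ < p₂ < q₂` with `p₁ ∼ p₂`, `q₁ ∼ q₂` and `p₂ ≁ q₁`. -/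
def NonCrossingRel {α : Type*} [LinearOrder α] (r : α → α → Prop) : Prop :=
  ∀ ⦃p₁ q₁ p₂ q₂ : α⦄, p₁ < q₁ → q₁ < p₂ → p₂ < q₂ → r p₁ p₂ → r q₁ q₂ → r p₂ q₁

/-- `π ∈ NC(n)`. -/
def NonCrossing (π : SetPartition n) : Prop := NonCrossingRel π.Rel

/-- The partition `π ∪ σ` of the ordered set `1 < 1̄ < 2 < 2̄ < ⋯ < n < n̄`, where `π` partitions the
plain elements `(i, false)` and `σ` the barred elements `(i, true)`. -/
def unionRel (π σ : SetPartition n) (a b : Fin n ×ₗ Bool) : Prop :=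
  match ofLex a, ofLex b with
  | (i, false), (j, false) => π.Rel i j
  | (i, true), (j, true) => σ.Rel i j
  | _, _ => False

/-- The relation "the set of elements lying in exactly one of `{x ≤ i}`, `{x ≤ j}` is a union of blocks
of `π`". -/
def krewerasSetoid (π : SetPartition n) : Setoid (Fin n) where
  r i j := ∀ x y, π.Rel x y → ((x ≤ i ↔ x ≤ j) ↔ (y ≤ i ↔ y ≤ j))
  iseqv :=
    { refl := fun i x y _ => by simp
      symm := fun {i j} h x y hxy => by
        have := h x y hxy
        tauto
      trans := fun {i j l} h₁ h₂ x y hxy => by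
        have := h₁ x y hxy
        have := h₂ x y hxy
        tauto }

open Classical in
/-- The Kreweras complement `K(π)`. By `isGreatest_kreweras` below, for non-crossing `π` it is the
largest partition `σ` of the barred elements such that `π ∪ σ` is non-crossing. -/
noncomputable def kreweras (π : SetPartition n) : SetPartition n :=
  Finpartition.ofSetoid π.krewerasSetoid

theorem rel_kreweras {π : SetPartition n} {i j : Fin n} :
    (kreweras π).Rel i j ↔
      ∀ x y, π.Rel x y → ((x ≤ i ↔ x ≤ j) ↔ (y ≤ i ↔ y ≤ j)) := by
  classical
  unfold Rel
  rw [← Finpartition.mem_part_iff_part_eq_part _ (Finset.mem_univ i) (Finset.mem_univ j)]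
  unfold kreweras
  rw [Finpartition.mem_part_ofSetoid_iff_rel]
  exact ⟨fun h => π.krewerasSetoid.symm h, fun h => π.krewerasSetoid.symm h⟩

theorem isGreatest_kreweras {π : SetPartition n} (hπ : π.NonCrossing) :
    IsGreatest {σ : SetPartition n | NonCrossingRel (unionRel π σ)} (kreweras π) := by
  constructor
  · intro p₁ q₁ p₂ q₂ h₁ h₂ h₃ hp hq
    obtain ⟨⟨a, x⟩, rfl⟩ := toLex.surjective p₁
    obtain ⟨⟨b, y⟩, rfl⟩ := toLex.surjective q₁
    obtain ⟨⟨c, z⟩, rfl⟩ := toLex.surjective p₂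
    obtain ⟨⟨d, w⟩, rfl⟩ := toLex.surjective q₂
    have tf : ¬ (true < false) := by decide
    rw [Prod.Lex.lt_iff] at h₁ h₂ h₃
    cases x <;> cases y <;> cases z <;> cases w <;>
      simp [unionRel, tf] at h₁ h₂ h₃ hp hq ⊢
    · exact hπ h₁ h₂ h₃ hp hq
    · have := rel_kreweras.1 hq a c hp
      grind
    · have := rel_kreweras.1 hp b d hq
      grind
    · rw [rel_kreweras] at *
      intro u v huv
      have := hp u v huv
      have := hq u v huv
      grind
  · intro σ hσ
    have key : ∀ i j, i < j → σ.Rel i j → (kreweras π).Rel i j := by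
      intro i j hij hs
      have aux : ∀ x y, π.Rel x y → i < x → x ≤ j → i < y ∧ y ≤ j := by
        intro x y hxy hx hxj
        by_contra hcon
        rw [not_and_or, not_lt, not_le] at hcon
        rcases hcon with hy | hy
        · have h := @hσ (toLex (y, false)) (toLex (i, true)) (toLex (x, false)) (toLex (j, true))
          simp [Prod.Lex.lt_iff, unionRel] at h
          exact h (lt_or_eq_of_le hy) (Or.inl hx) (lt_or_eq_of_le hxj) hxy.symm hs
        · have h := @hσ (toLex (i, true)) (toLex (x, false)) (toLex (j, true)) (toLex (y, false))
          simp [Prod.Lex.lt_iff, unionRel] at h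
          exact h (Or.inl hx) (lt_or_eq_of_le hxj) (Or.inl hy) hs hxy
      rw [rel_kreweras]
      intro x y hxy
      have h₁ := aux x y hxy
      have h₂ := aux y x hxy.symm
      grind
    have key' : ∀ i j, σ.Rel i j → (kreweras π).Rel i j := by
      intro i j h
      rcases lt_trichotomy i j with hl | rfl | hl
      · exact key i j hl h
      · rfl
      · exact (key j i hl h.symm).symm
    intro V hV
    obtain ⟨i, hi⟩ := σ.nonempty_of_mem_parts hV
    refine ⟨(kreweras π).part i, (kreweras π).part_mem.2 (Finset.mem_univ i), ?_⟩
    intro j hj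
    have hσij : σ.Rel i j := by
      unfold Rel
      rw [σ.part_eq_of_mem hV hi, σ.part_eq_of_mem hV hj]
    rw [Finpartition.mem_part_iff_part_eq_part _ (Finset.mem_univ j) (Finset.mem_univ i)]
    exact (key' i j hσij).symm

end SetPartition

/-! ## Boxed convolution -/

/-- The restriction `w|V` of the word `w` to the positions in `V`, taken in increasing order. -/
def wordRestrict {s : ℕ} (w : List (Fin s)) (V : Finset (Fin w.length)) : List (Fin s) :=
  ((List.finRange w.length).filter (· ∈ V)).map w.get

section Series

variable {s n : ℕ} {R : Type*} [CommRing R]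

/-- `X_{w,π}(f) = ∏_{V ∈ π} X_{w|V}(f)`, where a series is given by its coefficients `w ↦ X_w(f)`. -/
def coeffPartition (f : List (Fin s) → R) (w : List (Fin s)) (π : SetPartition w.length) : R :=
  ∏ V ∈ π.parts, f (wordRestrict w V)

open Classical in
/-- The coefficient `X_w(f ⊠ g) = ∑_{π ∈ NC(|w|)} X_{w,π}(f) X_{w,K(π)}(g)` of the boxed convolution,
for a non-empty word `w`. -/
noncomputable def boxCoeff (f g : List (Fin s) → R) (w : List (Fin s)) : R :=
  ∑ π : SetPartition w.length with π.NonCrossing,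
    coeffPartition f w π * coeffPartition g w π.kreweras

/-- Words `w` over the alphabet `[s]` with `1 ≤ |w| ≤ n`. -/
abbrev TruncWord (s n : ℕ) : Type := {w : List (Fin s) // 1 ≤ w.length ∧ w.length ≤ n}

/-- Truncated non-commutative series `∑_{1 ≤ |w| ≤ n} α_w z_w`. -/
abbrev TruncSeries (s n : ℕ) (R : Type*) : Type _ := TruncWord s n → R

/-- The coefficients of a truncated series, extended by zero to all words. -/
def TruncSeries.coeff (f : TruncSeries s n R) (w : List (Fin s)) : R :=
  if h : 1 ≤ w.length ∧ w.length ≤ n then f ⟨w, h⟩ else 0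

/-- The boxed convolution of truncated series. -/
noncomputable def TruncSeries.box (f g : TruncSeries s n R) : TruncSeries s n R :=
  fun w => boxCoeff f.coeff g.coeff w.1

theorem TruncSeries.box_letter (f g : TruncSeries s n R) (w : TruncWord s n)
    (hw : w.1.length = 1) : f.box g w = f w * g w := by
  classical
  obtain ⟨w, h⟩ := w
  obtain ⟨i, rfl⟩ := List.length_eq_one_iff.1 hw
  have hres : ∀ V : Finset (Fin [i].length), V.Nonempty → wordRestrict [i] V = [i] := by
    intro V hV
    obtain ⟨x, hx⟩ := hV
    have hx0 : x = (0 : Fin 1) := Subsingleton.elim (α := Fin 1) _ _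
    have : (0 : Fin 1) ∈ V := hx0 ▸ hx
    simp [wordRestrict, List.finRange_succ, this]
  have hpart : ∀ (f : TruncSeries s n R) (π : SetPartition [i].length),
      coeffPartition f.coeff [i] π = f ⟨[i], h⟩ := by
    intro f π
    have h1 : ∀ V ∈ π.parts, f.coeff (wordRestrict [i] V) = f ⟨[i], h⟩ := by
      intro V hV
      rw [hres V (π.nonempty_of_mem_parts hV)]
      simp only [TruncSeries.coeff]
      rw [dif_pos h]
    rw [coeffPartition, Finset.prod_congr rfl h1, Finset.prod_const]
    have hc : π.parts.card = 1 := by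
      apply le_antisymm
      · simpa using π.card_parts_le_card
      · rw [Nat.succ_le_iff, Finset.card_pos]
        exact ⟨_, π.part_mem.2 (Finset.mem_univ (0 : Fin 1))⟩
    rw [hc, pow_one]
  have hcard : (Finset.univ.filter
      (fun π : SetPartition [i].length => π.NonCrossing)).card = 1 := by
    have hall : ∀ π : SetPartition [i].length, π.NonCrossing := by
      intro π p q _ _ hpq _ _ _ _
      have : p = q := Subsingleton.elim (α := Fin 1) _ _
      exact absurd hpq (this ▸ lt_irrefl _)
    have huniq : ∀ π σ : SetPartition [i].length, π = σ := by
      intro π σ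
      have hp : ∀ π : SetPartition [i].length, π.parts = {Finset.univ} := by
        intro π
        have hV : ∀ V ∈ π.parts, V = Finset.univ := by
          intro V hV
          obtain ⟨x, hx⟩ := π.nonempty_of_mem_parts hV
          ext y
          have : y = x := Subsingleton.elim (α := Fin 1) _ _
          exact ⟨fun _ => Finset.mem_univ _, fun _ => this ▸ hx⟩
        refine Finset.eq_singleton_iff_nonempty_unique_mem.2 ⟨?_, hV⟩
        exact ⟨_, π.part_mem.2 (Finset.mem_univ (0 : Fin 1))⟩
      exact Finpartition.ext ((hp π).trans (hp σ).symm)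
    rw [Finset.filter_true_of_mem (fun π _ => hall π), Finset.card_eq_one]
    exact ⟨⊤, Finset.eq_singleton_iff_unique_mem.2
      ⟨Finset.mem_univ _, fun σ _ => huniq _ _⟩⟩
  simp only [TruncSeries.box, boxCoeff, hpart]
  rw [Finset.sum_const, hcard, one_smul]

end Series

/-! ## The truncated groups -/

/-- `(𝔊ˢ)ₙ(R)`: truncated series whose coefficients at words of length one are units. -/
def TruncG (s n : ℕ) (R : Type*) [CommRing R] : Type _ :=
  {f : TruncSeries s n R // ∀ w : TruncWord s n, w.1.length = 1 → IsUnit (f w)}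

/-- `(𝔊ˢ₊)ₙ(R)`: truncated series whose coefficients at words of length one are equal to `1`. -/
def TruncGPlus (s n : ℕ) (R : Type*) [CommRing R] : Type _ :=
  {f : TruncSeries s n R // ∀ w : TruncWord s n, w.1.length = 1 → f w = 1}

section Groups

variable {s n : ℕ}

/-- The multiplication of `(𝔊ˢ)ₙ(R)` is the boxed convolution. -/
noncomputable instance {R : Type*} [CommRing R] : Mul (TruncG s n R) where
  mul f g := ⟨f.1.box g.1, fun w hw => by
    rw [TruncSeries.box_letter _ _ w hw]
    exact (f.2 w hw).mul (g.2 w hw)⟩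

/-- The multiplication of `(𝔊ˢ₊)ₙ(R)` is the boxed convolution. -/
noncomputable instance {R : Type*} [CommRing R] : Mul (TruncGPlus s n R) where
  mul f g := ⟨f.1.box g.1, fun w hw => by
    rw [TruncSeries.box_letter _ _ w hw, f.2 w hw, g.2 w hw, mul_one]⟩

/-- The functor `(𝔊ˢ)ₙ` on morphisms. -/
def TruncG.map {R R' : Type*} [CommRing R] [CommRing R'] (φ : R →+* R') (f : TruncG s n R) :
    TruncG s n R' :=
  ⟨fun w => φ (f.1 w), fun w hw => (f.2 w hw).map φ⟩

/-- The functor `(𝔊ˢ₊)ₙ` on morphisms. -/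
def TruncGPlus.map {R R' : Type*} [CommRing R] [CommRing R'] (φ : R →+* R')
    (f : TruncGPlus s n R) : TruncGPlus s n R' :=
  ⟨fun w => φ (f.1 w), fun w hw => (congrArg φ (f.2 w hw)).trans (map_one φ)⟩

end Groups

/-! ## Matrix groups -/

section MatrixSubgroups

variable (N : ℕ) (R : Type*) [CommRing R]

/-- The Borel group `𝔹_N(R)` of invertible upper-triangular matrices. -/
def borelGroup : Subgroup (GL (Fin N) R) where
  carrier := {M | ∀ i j : Fin N, j < i → M.1 i j = 0}
  one_mem' := fun i j hij => by simp [Matrix.one_apply_ne hij.ne']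
  mul_mem' := fun {A B} hA hB => by
    have := Matrix.BlockTriangular.mul (b := id) (M := A.1) (N := B.1) hA hB
    exact this
  inv_mem' := fun {A} hA => by
    let _ : Invertible A.1 := A.invertible
    have := Matrix.blockTriangular_inv_of_blockTriangular (b := id) (M := A.1) hA
    intro i j hij
    rw [Matrix.coe_units_inv]
    exact this hij

theorem borelGroup_mul_diag {A B : GL (Fin N) R} (hA : A ∈ borelGroup N R)
    (hB : B ∈ borelGroup N R) (i : Fin N) : (A * B).1 i i = A.1 i i * B.1 i i := by
  change (A.1 * B.1) i i = _
  rw [Matrix.mul_apply]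
  refine Finset.sum_eq_single i (fun j _ hj => ?_) (by simp)
  rcases lt_or_gt_of_ne hj with h | h
  · rw [hA i j h, zero_mul]
  · rw [hB j i h, mul_zero]

/-- The unipotent group `𝕌_N(R)` of upper-triangular matrices with all diagonal entries `1`. -/
def unipotentGroup : Subgroup (GL (Fin N) R) where
  carrier := {M | M ∈ borelGroup N R ∧ ∀ i, M.1 i i = 1}
  one_mem' := ⟨one_mem _, fun i => by simp⟩
  mul_mem' := fun {A B} hA hB => ⟨mul_mem hA.1 hB.1, fun i => by
    rw [borelGroup_mul_diag N R hA.1 hB.1, hA.2, hB.2, mul_one]⟩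
  inv_mem' := fun {A} hA => ⟨inv_mem hA.1, fun i => by
    have h := borelGroup_mul_diag N R hA.1 (inv_mem hA.1) i
    rw [hA.2, one_mul, mul_inv_cancel] at h
    rw [← h]
    simp⟩

/-- The torus `𝕋_N(R)` of invertible diagonal matrices `diag(t₁, …, t_N)`. -/
def torusGroup : Subgroup (GL (Fin N) R) where
  carrier := {M | ∃ t : Fin N → Rˣ, M.1 = Matrix.diagonal (fun i => (t i : R))}
  one_mem' := ⟨1, by simp⟩
  mul_mem' := by
    rintro A B ⟨t, ht⟩ ⟨u, hu⟩
    exact ⟨t * u, by simp [ht, hu]⟩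
  inv_mem' := by
    rintro A ⟨t, ht⟩
    refine ⟨t⁻¹, ?_⟩
    change (A⁻¹ : GL (Fin N) R).1 = _
    rw [Matrix.coe_units_inv]
    refine Matrix.inv_eq_right_inv ?_
    rw [ht, Matrix.diagonal_mul_diagonal]
    simp

end MatrixSubgroups

universe u

/-- A family of subgroups `H(R) ≤ GL_N(R)`, for commutative `k`-algebras `R`, is a closed subgroup of
`GL_N` over `k` if it is cut out, for all `R` simultaneously, by polynomial equations in the matrix
entries with coefficients in `k`. -/
def IsClosedSubgroup (k : Type u) [Field k] {N : ℕ}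
    (H : ∀ (R : Type u) [CommRing R] [Algebra k R], Subgroup (GL (Fin N) R)) : Prop :=
  ∃ S : Set (MvPolynomial (Fin N × Fin N) k),
    ∀ (R : Type u) [CommRing R] [Algebra k R] (M : GL (Fin N) R),
      M ∈ H R ↔ ∀ p ∈ S, MvPolynomial.aeval (fun ij : Fin N × Fin N => M.1 ij.1 ij.2) p = 0

/-!
The group `(𝔊ˢ)ₙ` acts on polynomial functions in the coefficients `X_w` of a series by right
translation. Give `X_w` the weight `|w|`. The blocks of a partition of the positions of `w` have total
length `|w|`, so the translation `X_w ↦ (X ⊠ g)_w` preserves weights, and the polynomials spanned by the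
monomials of weight at most `n` form a free module of finite rank `N`, independent of the base ring,
which contains all coordinates `X_w`. The matrices of the action on this module are `repMatrix g`.

* They are triangular. In `(X ⊠ g)_w` the partition with one block contributes `X_w` times the product
  of the coefficients of `g` at the letters of `w`; all other partitions contribute products of at
  least two coordinates. Hence translation is triangular with respect to the degree
  (`coeff_subst_monomial`), and the diagonal entries are products of letter coefficients.
* They determine `g`: evaluating the translate of `X_w` at the unit `delta` gives `g_w`
  (`ofMatrix_repMatrix`). So the image is cut out by the equations `M = repMatrix (ofMatrix M)`, which
  are polynomial because `repMatrix` and `ofMatrix` commute with ring homomorphisms and can be evaluated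
  at the generic matrix. The unipotent case adds the equations that letter coefficients equal `1`.
* They multiply correctly because boxed convolution is associative (`box_assoc`). The image is closed
  under inverses because `f ⊠ g = delta` can be solved for `f` by recursion on the length of words
  (`exists_box_eq_delta`).

Associativity is combinatorial. For non-crossing `τ ≤ π`, the Kreweras complement of `τ` taken inside the
blocks of `π` is `π ⊓ K(τ)` (`bind_krew`), so both bracketings are sums over pairs: `τ ≤ π` on the left,
with weights at `τ`, `π ⊓ K(τ)`, `K(π)`, and `ρ ≤ K(τ)` on the right, with weights at `τ`, `ρ`,
`K(τ) ⊓ K(ρ)`. The map `π ↦ π ⊓ K(τ)` matches the two sums: `K(π) = K(τ) ⊓ K(π ⊓ K(τ))`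
(`krew_eq_inf`), it is injective since `π` is the join of `τ` and `π ⊓ K(τ)` (`saturated_of_le`), and it
is onto by a count, as `K` is an order-reversing bijection of the non-crossing partitions
(`le_of_krew_le`). All of this is done for functions on the finite subsets of a linear order; for a word
`w` one uses `V ↦ f (w|V)` on sets of positions.
-/

/-! ### Partitions of a finite set and their Kreweras complements -/

namespace Finpartition

section Rel

variable {α : Type*} [DecidableEq α] {S : Finset α} {π σ : Finpartition S} {x y z : α}

/-- `x` and `y` lie in a common block of the partition `π` of the finite set `S`. -/
def Rel (π : Finpartition S) (x y : α) : Prop := ∃ B ∈ π.parts, x ∈ B ∧ y ∈ B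

theorem Rel.symm (h : π.Rel x y) : π.Rel y x := by
  obtain ⟨B, hB, hx, hy⟩ := h
  exact ⟨B, hB, hy, hx⟩

theorem Rel.trans (h : π.Rel x y) (h' : π.Rel y z) : π.Rel x z := by
  obtain ⟨B, hB, hx, hy⟩ := h
  obtain ⟨C, hC, hy', hz⟩ := h'
  obtain rfl := π.eq_of_mem_parts hB hC hy hy'
  exact ⟨B, hB, hx, hz⟩

theorem Rel.mem_left (h : π.Rel x y) : x ∈ S := by
  obtain ⟨B, hB, hx, -⟩ := h
  exact π.subset hB hx

theorem Rel.mem_right (h : π.Rel x y) : y ∈ S := h.symm.mem_left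

theorem rel_refl (hx : x ∈ S) : π.Rel x x := by
  obtain ⟨B, hB, hx⟩ := π.exists_mem hx
  exact ⟨B, hB, hx, hx⟩

theorem rel_iff_mem_part : π.Rel x y ↔ y ∈ π.part x := by
  rw [mem_part_iff_exists]
  exact exists_congr fun B => and_congr_right fun _ => and_comm

theorem rel_iff_mem_of_mem_parts {B : Finset α} (hB : B ∈ π.parts) (hx : x ∈ B) :
    π.Rel x y ↔ y ∈ B := by
  rw [rel_iff_mem_part, π.part_eq_of_mem hB hx]

theorem le_iff_rel : π ≤ σ ↔ ∀ x y, π.Rel x y → σ.Rel x y := by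
  constructor
  · rintro h x y ⟨B, hB, hx, hy⟩
    obtain ⟨C, hC, hBC⟩ := h hB
    exact ⟨C, hC, hBC hx, hBC hy⟩
  · intro h B hB
    obtain ⟨x, hx⟩ := π.nonempty_of_mem_parts hB
    refine ⟨σ.part x, σ.part_mem.2 (π.subset hB hx), fun y hy => ?_⟩
    exact rel_iff_mem_part.1 (h x y ⟨B, hB, hx, hy⟩)

theorem eq_of_rel_iff (h : ∀ x y, π.Rel x y ↔ σ.Rel x y) : π = σ :=
  le_antisymm (le_iff_rel.2 fun x y => (h x y).1) (le_iff_rel.2 fun x y => (h x y).2)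

theorem rel_inf : (π ⊓ σ).Rel x y ↔ π.Rel x y ∧ σ.Rel x y := by
  constructor
  · intro h
    exact ⟨le_iff_rel.1 inf_le_left _ _ h, le_iff_rel.1 inf_le_right _ _ h⟩
  · rintro ⟨⟨B, hB, hx, hy⟩, ⟨C, hC, hx', hy'⟩⟩
    have hxBC : x ∈ B ⊓ C := Finset.mem_inter.2 ⟨hx, hx'⟩
    refine ⟨B ⊓ C, ?_, hxBC, Finset.mem_inter.2 ⟨hy, hy'⟩⟩
    rw [parts_inf, Finset.mem_erase]
    exact ⟨fun h => by simp [h] at hxBC,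
      Finset.mem_image.2 ⟨(B, C), Finset.mem_product.2 ⟨hB, hC⟩, rfl⟩⟩

theorem rel_bind {Q : ∀ B ∈ π.parts, Finpartition B} :
    (π.bind Q).Rel x y ↔ ∃ B, ∃ hB : B ∈ π.parts, (Q B hB).Rel x y := by
  simp only [Rel, mem_bind]
  grind

theorem rel_ofSetSetoid (s : Setoid α) [DecidableRel s.r] :
    (ofSetSetoid s S).Rel x y ↔ x ∈ S ∧ y ∈ S ∧ s x y := by
  rw [rel_iff_mem_part, mem_part_ofSetSetoid_iff_rel]

theorem rel_top (hx : x ∈ S) (hy : y ∈ S) : (⊤ : Finpartition S).Rel x y := by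
  classical
  have h : (ofSetSetoid (⊤ : Setoid α) S).Rel x y := (rel_ofSetSetoid _).2 ⟨hx, hy, trivial⟩
  exact le_iff_rel.1 le_top _ _ h

theorem rel_bot : (⊥ : Finpartition S).Rel x y ↔ x ∈ S ∧ x = y := by
  simp only [Rel, mem_bot_iff]
  grind

end Rel

section Kreweras

variable {α : Type*} [LinearOrder α] {S : Finset α} {π σ τ : Finpartition S}

/-- A partition of a finite subset of a linear order is non-crossing if its block relation is. -/
def IsNonCrossing (π : Finpartition S) : Prop := SetPartition.NonCrossingRel π.Rel

/-- The relation "no block of `π` meets both the half-open interval between `i` and `j` and its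
complement". -/
def krewSetoid (π : Finpartition S) : Setoid α where
  r i j := ∀ x y, π.Rel x y → ((x ≤ i ↔ x ≤ j) ↔ (y ≤ i ↔ y ≤ j))
  iseqv :=
    { refl := fun i x y _ => by simp
      symm := fun {i j} h x y hxy => by
        have := h x y hxy
        tauto
      trans := fun {i j l} h₁ h₂ x y hxy => by
        have := h₁ x y hxy
        have := h₂ x y hxy
        tauto }

open Classical in
/-- The Kreweras complement of a partition of a finite subset `S` of a linear order, as a partition
of `S` itself: `i` in the complement stands for the barred point right after `i`. -/
noncomputable def krew (π : Finpartition S) : Finpartition S := ofSetSetoid π.krewSetoid S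

theorem rel_krew {i j : α} : π.krew.Rel i j ↔
    i ∈ S ∧ j ∈ S ∧ ∀ x y, π.Rel x y → ((x ≤ i ↔ x ≤ j) ↔ (y ≤ i ↔ y ≤ j)) := by
  classical
  exact rel_ofSetSetoid _

theorem rel_krew_of_lt {i j : α} (hi : i ∈ S) (hj : j ∈ S) (hij : i < j)
    (h : ∀ x y, π.Rel x y → i < x → x ≤ j → i < y ∧ y ≤ j) : π.krew.Rel i j := by
  refine rel_krew.2 ⟨hi, hj, fun x y hxy => ?_⟩
  have h₁ := h x y hxy
  have h₂ := h y x hxy.symm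
  grind

theorem isNonCrossing_krew (π : Finpartition S) : π.krew.IsNonCrossing := by
  intro a b c d hab hbc hcd hac hbd
  rw [rel_krew] at *
  refine ⟨hac.2.1, hbd.1, fun u v huv => ?_⟩
  have := hac.2.2 u v huv
  have := hbd.2.2 u v huv
  grind

theorem IsNonCrossing.inf (hπ : π.IsNonCrossing) (hσ : σ.IsNonCrossing) :
    (π ⊓ σ).IsNonCrossing := by
  intro a b c d hab hbc hcd hac hbd
  rw [rel_inf] at *
  exact ⟨hπ hab hbc hcd hac.1 hbd.1, hσ hab hbc hcd hac.2 hbd.2⟩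

theorem krew_anti (h : τ ≤ π) : π.krew ≤ τ.krew := by
  rw [le_iff_rel]
  intro i j hij
  rw [rel_krew] at *
  exact ⟨hij.1, hij.2.1, fun x y hxy => hij.2.2 x y (le_iff_rel.1 h x y hxy)⟩

theorem exists_max_of_mem {P : α → Prop} {x : α} (hx : x ∈ S) (hP : P x) :
    ∃ p ∈ S, P p ∧ ∀ z ∈ S, P z → z ≤ p := by
  classical
  obtain ⟨p, hp, h⟩ := (S.filter P).exists_max_image id ⟨x, by simp [hx, hP]⟩
  simp only [Finset.mem_filter, id] at hp h
  exact ⟨p, hp.1, hp.2, fun z hz hPz => h z ⟨hz, hPz⟩⟩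

theorem exists_min_of_mem {P : α → Prop} {x : α} (hx : x ∈ S) (hP : P x) :
    ∃ p ∈ S, P p ∧ ∀ z ∈ S, P z → p ≤ z := by
  classical
  obtain ⟨p, hp, h⟩ := (S.filter P).exists_min_image id ⟨x, by simp [hx, hP]⟩
  simp only [Finset.mem_filter, id] at hp h
  exact ⟨p, hp.1, hp.2, fun z hz hPz => h z ⟨hz, hPz⟩⟩

theorem rel_krew_Ico {i j u v : α} (hij : i < j) (h : π.Rel i j) (huv : π.krew.Rel u v)
    (hu : i ≤ u ∧ u < j) : i ≤ v ∧ v < j := by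
  have := (rel_krew.1 huv).2.2 i j h
  grind

/-- A non-crossing partition is recovered from its Kreweras complement: `i < j` lie in one block as soon
as `[i, j)` is a union of blocks of `K(π)`. If they did not, let `c` be the last element before `j` of
the block of `i`. The successor of `c` in that block (taken cyclically) is not in `(i, j]`, so `K(π)`
relates `c` to the predecessor of that successor, which lies outside `[i, j)`. -/
theorem IsNonCrossing.rel_of_Ico (hπ : π.IsNonCrossing) {i j : α} (hi : i ∈ S) (hj : j ∈ S)
    (hij : i < j) (h : ∀ u v, π.krew.Rel u v → i ≤ u ∧ u < j → i ≤ v ∧ v < j) : π.Rel i j := by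
  by_contra hn
  have hii : π.Rel i i := rel_refl hi
  obtain ⟨c, hc, ⟨hic, hcj⟩, hcmax⟩ :=
    exists_max_of_mem (P := fun z => π.Rel i z ∧ z < j) hi ⟨hii, hij⟩
  have hic' : i ≤ c := hcmax i hi ⟨hii, hij⟩
  by_cases hd : ∃ d, π.Rel i d ∧ j < d
  -- the block of `i` continues beyond `j`: its next element is `d`, with predecessor `p ≥ j` in `S`
  · obtain ⟨d, hd, hjd⟩ := hd
    obtain ⟨d, hdS, ⟨hid, hjd⟩, hdmin⟩ :=
      exists_min_of_mem (P := fun z => π.Rel i z ∧ j < z) hd.mem_right ⟨hd, hjd⟩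
    obtain ⟨p, hp, hpd, hpmax⟩ := exists_max_of_mem (P := fun z => z < d) hj hjd
    have hjp := hpmax j hj hjd
    have := h c p (rel_krew_of_lt hc hp (by order) fun u v huv hcu hup => ?_) ⟨hic', hcj⟩
    · order
    · have hu : ¬ π.Rel i u := fun hu => by
        rcases lt_trichotomy u j with h' | rfl | h'
        · exact absurd (hcmax u huv.mem_left ⟨hu, h'⟩) (by order)
        · exact hn hu
        · exact absurd (hdmin u huv.mem_left ⟨hu, h'⟩) (by order)
      have hv : ¬ π.Rel i v := fun hv => hu (hv.trans huv.symm)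
      have hcd : π.Rel c d := hic.symm.trans hid
      constructor
      · by_contra! hvc
        rcases hvc.lt_or_eq with hvc | rfl
        · exact hv (hic.trans (hπ hvc hcu (by order) huv.symm hcd |>.symm.trans huv))
        · exact hv hic
      · by_contra! hpv
        rcases lt_trichotomy v d with h' | rfl | h'
        · exact absurd (hpmax v huv.mem_right h') (by order)
        · exact hv hid
        · exact hu (hid.trans (hπ hcu (by order) h' hcd huv))
  -- `c` is the last element of the block, and the cyclic successor is the first element `m`
  · push Not at hd
    have hcl : ∀ z, π.Rel i z → z ≤ c := fun z hz => by
      rcases lt_trichotomy z j with h' | rfl | h'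
      · exact hcmax z hz.mem_right ⟨hz, h'⟩
      · exact absurd hz hn
      · exact absurd (hd z hz) (by order)
    obtain ⟨m, hm, him, hmmin⟩ := exists_min_of_mem (P := fun z => π.Rel i z) hi hii
    have hmi := hmmin i hi hii
    have hmc : π.Rel m c := him.symm.trans hic
    -- a point strictly between `m` and `c` stays there along its block
    have key : ∀ u v, π.Rel u v → m ≤ u → u ≤ c → m ≤ v ∧ v ≤ c := by
      intro u v huv hmu huc
      by_cases hu : π.Rel i u
      · exact ⟨hmmin v huv.mem_right (hu.trans huv), hcl v (hu.trans huv)⟩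
      have hmu' : m < u := lt_of_le_of_ne hmu (by rintro rfl; exact hu him)
      have huc' : u < c := lt_of_le_of_ne huc (by rintro rfl; exact hu hic)
      constructor
      · by_contra! hv
        exact hu (him.trans ((hπ hv hmu' huc' huv.symm hmc).symm))
      · by_contra! hv
        exact hu (hic.trans (hπ hmu' huc' hv hmc huv))
    by_cases hp : ∃ p ∈ S, p < m
    · obtain ⟨p, hpS, hpm⟩ := hp
      obtain ⟨p, hp, hpm, hpmax⟩ := exists_max_of_mem (P := fun z => z < m) hpS hpm
      have hle : ∀ z ∈ S, p < z → m ≤ z := fun z hz hpz => by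
        by_contra! hzm
        exact absurd (hpmax z hz hzm) (by order)
      have := h c p (rel_krew_of_lt hp hc (by order) fun u v huv hpu huc => ?_).symm ⟨hic', hcj⟩
      · order
      · have := key u v huv (hle u huv.mem_left hpu) huc
        exact ⟨by order, this.2⟩
    -- `m` is the first element of `S`, and its cyclic predecessor is the last one
    · push Not at hp
      obtain ⟨p, hpS, -, hpmax⟩ := exists_max_of_mem (P := fun _ => True) hj trivial
      have hjp := hpmax j hj trivial
      have := h c p (rel_krew_of_lt hc hpS (by order) fun u v huv hcu hup => ?_) ⟨hic', hcj⟩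
      · order
      · refine ⟨?_, hpmax v huv.mem_right trivial⟩
        by_contra! hvc
        exact absurd (key v u huv.symm (hp v huv.mem_right) hvc).2 (by order)

/-- On non-crossing partitions the Kreweras complement reflects the refinement order. -/
theorem IsNonCrossing.le_of_krew_le (hπ : π.IsNonCrossing) (h : π.krew ≤ τ.krew) : τ ≤ π := by
  rw [le_iff_rel] at *
  have key : ∀ i j, i < j → τ.Rel i j → π.Rel i j := fun i j hij hτ =>
    hπ.rel_of_Ico hτ.mem_left hτ.mem_right hij fun u v huv hu => rel_krew_Ico hij hτ (h u v huv) hu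
  intro i j hij
  rcases lt_trichotomy i j with hl | rfl | hl
  · exact key i j hl hij
  · exact rel_refl hij.mem_left
  · exact (key j i hl hij.symm).symm

/-- For `τ ≤ π`, the partition `π` is the join of `τ` and of the relative complement `π ⊓ K(τ)`:
a set which is a union of blocks of both of them is a union of blocks of `π`. -/
theorem IsNonCrossing.saturated_of_le (hτ : τ.IsNonCrossing) (hπ : π.IsNonCrossing) (h : τ ≤ π)
    {E : α → Prop} (h₁ : ∀ x y, τ.Rel x y → (E x ↔ E y))
    (h₂ : ∀ x y, π.Rel x y → τ.krew.Rel x y → (E x ↔ E y)) {x y : α} (hxy : π.Rel x y) :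
    E x ↔ E y := by
  rw [le_iff_rel] at h
  suffices key : ∀ y, ¬ ∃ x, x < y ∧ π.Rel x y ∧ ¬ (E x ↔ E y) by
    rcases lt_trichotomy x y with hl | rfl | hl
    · by_contra hE
      exact key y ⟨x, hl, hxy, hE⟩
    · rfl
    · by_contra hE
      exact key x ⟨y, hl, hxy.symm, fun h' => hE h'.symm⟩
  rintro y ⟨x, hx⟩
  -- a minimal counterexample `y`, with predecessor `p` in its block of `π`
  obtain ⟨y, hy, ⟨x, hxy, hπxy, hE⟩, hmin⟩ := exists_min_of_mem (S := S)
    (P := fun y => ∃ x, x < y ∧ π.Rel x y ∧ ¬ (E x ↔ E y)) hx.2.1.mem_right ⟨x, hx⟩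
  obtain ⟨p, hp, ⟨hpy, hπp⟩, hpmax⟩ :=
    exists_max_of_mem (S := S) (P := fun z => z < y ∧ π.Rel z y) hπxy.mem_left ⟨hxy, hπxy⟩
  have hxp := hpmax x hπxy.mem_left ⟨hxy, hπxy⟩
  have hExp : E x ↔ E p := by
    by_contra hE'
    rcases hxp.lt_or_eq with hlt | rfl
    · exact absurd (hmin p hp ⟨x, hlt, hπxy.trans hπp.symm, hE'⟩) (by order)
    · exact hE' Iff.rfl
  apply hE
  rw [hExp]
  have hgap : ∀ z, p < z → z < y → ¬ π.Rel z y := fun z hz hzy hπz =>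
    absurd (hpmax z hπz.mem_left ⟨hzy, hπz⟩) (by order)
  -- the gap between `p` and `y` is a union of blocks of `τ`
  have hgap' : ∀ u v, τ.Rel u v → p < u → u < y → p < v ∧ v < y := by
    intro u v huv hpu huy
    have hu := hgap u hpu huy
    constructor
    · by_contra! hvp
      rcases hvp.lt_or_eq with hvp | rfl
      · exact hu ((hπ hvp hpu huy (h _ _ huv.symm) hπp).trans hπp)
      · exact hu ((h _ _ huv).trans hπp)
    · by_contra! hyv
      rcases hyv.lt_or_eq with hyv | rfl
      · exact hu (hπ hpu huy hyv hπp (h _ _ huv)).symm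
      · exact hu (h _ _ huv)
  by_cases hq : ∃ q, q < y ∧ τ.Rel q y
  -- the predecessor `q` of `y` in its block of `τ` is related to `p` by `K(τ)`
  · obtain ⟨q, hqy, hτq⟩ := hq
    obtain ⟨q, hq, ⟨hqy, hτq⟩, hqmax⟩ :=
      exists_max_of_mem (S := S) (P := fun z => z < y ∧ τ.Rel z y) hτq.mem_left ⟨hqy, hτq⟩
    have hqp := hpmax q hq ⟨hqy, h _ _ hτq⟩
    rw [← h₁ q y hτq]
    rcases hqp.lt_or_eq with hqp | rfl
    · refine (h₂ q p ((h _ _ hτq).trans hπp.symm)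
        (rel_krew_of_lt hq hp hqp fun u v huv hqu hup => ?_)).symm
      have hu : ¬ τ.Rel u y := fun hu =>
        absurd (hqmax u hu.mem_left ⟨by order, hu⟩) (by order)
      constructor
      · by_contra! hvq
        rcases hvq.lt_or_eq with hvq | rfl
        · exact hu ((hτ hvq hqu (by order) huv.symm hτq).trans hτq)
        · exact hu (huv.trans hτq)
      · by_contra! hpv
        rcases lt_trichotomy v y with h' | rfl | h'
        · exact absurd (hgap' v u huv.symm hpv h').1 (by order)
        · exact hu huv
        · exact hu (hτ hqu (by order) h' hτq huv).symm
    · rfl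
  -- `y` is the first element of its block of `τ`, and `K(τ)` relates `p` to the last element `m`
  · push Not at hq
    obtain ⟨m, hm, hτm, hmmax⟩ :=
      exists_max_of_mem (S := S) (P := fun z => τ.Rel y z) hy (rel_refl hy)
    have hym := hmmax y hy (rel_refl hy)
    rw [h₁ y m hτm]
    refine h₂ p m (hπp.trans (h _ _ hτm))
      (rel_krew_of_lt hp hm (by order) fun u v huv hpu hum => ?_)
    by_cases hu : τ.Rel y u
    · have hv := hu.trans huv
      refine ⟨?_, hmmax v hv.mem_right hv⟩
      by_contra! hvp
      exact hq v (by order) hv.symm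
    rcases lt_trichotomy u y with huy | rfl | hyu
    · have := hgap' u v huv hpu huy
      exact ⟨this.1, by order⟩
    · exact absurd (rel_refl hy) hu
    · have hum : u < m := lt_of_le_of_ne hum (by rintro rfl; exact hu hτm)
      constructor
      · by_contra! hvp
        exact hu (hτ (by order : v < y) hyu hum huv.symm hτm).symm
      · by_contra! hmv
        exact hu (hτm.trans (hτ hyu hum hmv hτm huv))

theorem IsNonCrossing.krew_injective (hπ : π.IsNonCrossing) (hσ : σ.IsNonCrossing)
    (h : π.krew = σ.krew) : π = σ :=
  le_antisymm (hσ.le_of_krew_le h.ge) (hπ.le_of_krew_le h.le)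

/-- The complement of `π ≥ τ` is the complement of the relative complement `π ⊓ K(τ)`, taken relative
to `K(τ)`: a set is a union of blocks of `π` if it is one for both `τ` and `π ⊓ K(τ)`. -/
theorem IsNonCrossing.krew_eq_inf (hτ : τ.IsNonCrossing) (hπ : π.IsNonCrossing) (h : τ ≤ π) :
    π.krew = τ.krew ⊓ (π ⊓ τ.krew).krew := by
  refine le_antisymm (le_inf (krew_anti h) (krew_anti inf_le_left)) ?_
  rw [le_iff_rel]
  intro i j hij
  rw [rel_inf, rel_krew, rel_krew] at hij
  obtain ⟨⟨hi, hj, h₁⟩, -, -, h₂⟩ := hij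
  refine rel_krew.2 ⟨hi, hj, fun x y hxy => ?_⟩
  exact hτ.saturated_of_le hπ h (E := fun x => (x ≤ i ↔ x ≤ j)) h₁
    (fun u v huv huv' => h₂ u v (rel_inf.2 ⟨huv, huv'⟩)) hxy

/-- The relative complement `π ⊓ K(τ)` determines `π` among the non-crossing partitions above `τ`. -/
theorem IsNonCrossing.eq_of_inf_krew_eq (hτ : τ.IsNonCrossing) (hπ : π.IsNonCrossing)
    (hσ : σ.IsNonCrossing) (hτπ : τ ≤ π) (hτσ : τ ≤ σ) (h : π ⊓ τ.krew = σ ⊓ τ.krew) : π = σ := by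
  have key : ∀ {π σ : Finpartition S}, π.IsNonCrossing → τ ≤ π → τ ≤ σ →
      π ⊓ τ.krew = σ ⊓ τ.krew → π ≤ σ := by
    intro π σ hπ hτπ hτσ h
    rw [le_iff_rel]
    intro x y hxy
    refine (hτ.saturated_of_le hπ hτπ (E := fun z => σ.Rel x z) (fun u v huv => ?_)
      (fun u v huv huv' => ?_) hxy).1 (rel_refl hxy.mem_left)
    · have := le_iff_rel.1 hτσ _ _ huv
      exact ⟨fun h => h.trans this, fun h => h.trans this.symm⟩
    · have : (σ ⊓ τ.krew).Rel u v := h ▸ rel_inf.2 ⟨huv, huv'⟩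
      have := (rel_inf.1 this).1
      exact ⟨fun h => h.trans this, fun h => h.trans this.symm⟩
  exact le_antisymm (key hπ hτπ hτσ h) (key hσ hτσ hτπ h.symm)

/-- Every non-crossing `ρ ≤ K(τ)` is a relative complement `π ⊓ K(τ)` with `π ≥ τ` non-crossing.
The map `π ↦ π ⊓ K(τ)` is injective, and the two finite sets have the same cardinality because `K` is
an order-reversing bijection of the set of non-crossing partitions. -/
theorem IsNonCrossing.exists_inf_krew_eq (hτ : τ.IsNonCrossing) {ρ : Finpartition S}
    (hρ : ρ.IsNonCrossing) (h : ρ ≤ τ.krew) :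
    ∃ π : Finpartition S, π.IsNonCrossing ∧ τ ≤ π ∧ π ⊓ τ.krew = ρ := by
  classical
  let A : Finset (Finpartition S) := {π | π.IsNonCrossing ∧ τ ≤ π}
  let B : Finset (Finpartition S) := {ρ | ρ.IsNonCrossing ∧ ρ ≤ τ.krew}
  have hsurj : ∀ σ : Finpartition S, σ.IsNonCrossing →
      ∃ π : Finpartition S, π.IsNonCrossing ∧ π.krew = σ := by
    let K : {π : Finpartition S // π.IsNonCrossing} → {π : Finpartition S // π.IsNonCrossing} :=
      fun π => ⟨π.1.krew, isNonCrossing_krew _⟩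
    have hK : Function.Injective K := fun π σ h =>
      Subtype.ext (π.2.krew_injective σ.2 (congrArg Subtype.val h))
    intro σ hσ
    obtain ⟨π, hπ⟩ := Finite.injective_iff_surjective.1 hK ⟨σ, hσ⟩
    exact ⟨π.1, π.2, congrArg Subtype.val hπ⟩
  have hBA : B ⊆ A.image krew := fun σ hσ => by
    simp only [B, Finset.mem_filter, Finset.mem_univ, true_and] at hσ
    obtain ⟨π, hπ, rfl⟩ := hsurj σ hσ.1
    exact Finset.mem_image_of_mem _ (by simp [A, hπ, hπ.le_of_krew_le hσ.2])
  have hAB : A.image (· ⊓ τ.krew) ⊆ B := by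
    intro σ hσ
    obtain ⟨π, hπ, rfl⟩ := Finset.mem_image.1 hσ
    simp only [A, Finset.mem_filter, Finset.mem_univ, true_and] at hπ
    simp only [B, Finset.mem_filter, Finset.mem_univ, true_and]
    exact ⟨hπ.1.inf (isNonCrossing_krew _), inf_le_right⟩
  have hcard : (A.image (· ⊓ τ.krew)).card = A.card := by
    refine Finset.card_image_of_injOn fun π hπ σ hσ h => ?_
    simp only [A, Finset.coe_filter, Finset.mem_univ, true_and, Set.mem_ofPred_eq] at hπ hσ
    exact hτ.eq_of_inf_krew_eq hπ.1 hσ.1 hπ.2 hσ.2 h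
  have heq := Finset.eq_of_subset_of_card_le hAB
    (hcard ▸ (Finset.card_le_card hBA).trans Finset.card_image_le)
  have hρB : ρ ∈ A.image (· ⊓ τ.krew) := by
    rw [heq]
    simp [B, hρ, h]
  obtain ⟨π, hπ, h⟩ := Finset.mem_image.1 hρB
  simp only [A, Finset.mem_filter, Finset.mem_univ, true_and] at hπ
  exact ⟨π, hπ.1, hπ.2, h⟩

end Kreweras
end Finpartition

/-! ### Boxed convolution on finite sets and its associativity -/

namespace Finpartition

section Bind

variable {α : Type*} [LinearOrder α] {S : Finset α} {π ρ : Finpartition S}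

theorem mem_parts_restrict {B V : Finset α} (hB : B ≤ S) :
    V ∈ (π.restrict hB).parts ↔ V ≠ ∅ ∧ ∃ C ∈ π.parts, C ∩ B = V := by
  rw [restrict]
  simp

theorem rel_restrict {B : Finset α} (hB : B ≤ S) {x y : α} :
    (π.restrict hB).Rel x y ↔ π.Rel x y ∧ x ∈ B ∧ y ∈ B := by
  simp only [Rel, mem_parts_restrict]
  constructor
  · rintro ⟨_, ⟨-, V, hV, rfl⟩, hx, hy⟩
    simp only [Finset.mem_inter] at hx hy
    exact ⟨⟨V, hV, hx.1, hy.1⟩, hx.2, hy.2⟩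
  · rintro ⟨⟨V, hV, hx, hy⟩, hxB, hyB⟩
    have hx' : x ∈ V ∩ B := Finset.mem_inter.2 ⟨hx, hxB⟩
    exact ⟨V ∩ B, ⟨Finset.ne_empty_of_mem hx', V, hV, rfl⟩, hx', Finset.mem_inter.2 ⟨hy, hyB⟩⟩

theorem rel_bind_of_mem {Q : ∀ B ∈ π.parts, Finpartition B} {B : Finset α} (hB : B ∈ π.parts)
    {x y : α} (hx : x ∈ B) : (π.bind Q).Rel x y ↔ (Q B hB).Rel x y := by
  rw [rel_bind]
  constructor
  · rintro ⟨C, hC, h⟩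
    obtain rfl := π.eq_of_mem_parts hB hC hx h.mem_left
    exact h
  · exact fun h => ⟨B, hB, h⟩

theorem bind_le (Q : ∀ B ∈ π.parts, Finpartition B) : π.bind Q ≤ π := by
  rw [le_iff_rel]
  intro x y h
  obtain ⟨B, hB, h⟩ := rel_bind.1 h
  exact ⟨B, hB, h.mem_left, h.mem_right⟩

theorem bind_restrict (h : ρ ≤ π) : (π.bind fun _ hB => ρ.restrict (π.le hB)) = ρ := by
  refine eq_of_rel_iff fun x y => ?_
  simp only [rel_bind, rel_restrict]
  constructor
  · rintro ⟨_, _, h, _⟩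
    exact h
  · intro hxy
    obtain ⟨B, hB, hx, hy⟩ := le_iff_rel.1 h _ _ hxy
    exact ⟨B, hB, hxy, hx, hy⟩

theorem IsNonCrossing.bind (hπ : π.IsNonCrossing) {Q : ∀ B ∈ π.parts, Finpartition B}
    (hQ : ∀ B hB, (Q B hB).IsNonCrossing) : (π.bind Q).IsNonCrossing := by
  intro a b c d hab hbc hcd hac hbd
  have h := hπ hab hbc hcd (le_iff_rel.1 (bind_le Q) _ _ hac) (le_iff_rel.1 (bind_le Q) _ _ hbd)
  obtain ⟨B, hB, hac⟩ := rel_bind.1 hac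
  have hb := (rel_iff_mem_of_mem_parts hB hac.mem_right).1 h
  rw [rel_bind_of_mem hB hb] at hbd
  exact (rel_bind_of_mem hB hac.mem_right).2 (hQ B hB hab hbc hcd hac hbd)

/-- Kreweras complements taken inside each block of a non-crossing partition `π` assemble to the
relative complement. -/
theorem IsNonCrossing.bind_krew (hπ : π.IsNonCrossing) (Q : ∀ B ∈ π.parts, Finpartition B) :
    (π.bind fun B hB => (Q B hB).krew) = π ⊓ (π.bind Q).krew := by
  have key : ∀ {B : Finset α} (hB : B ∈ π.parts) {i j : α}, i < j → (Q B hB).krew.Rel i j →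
      (π.bind Q).krew.Rel i j := by
    intro B hB i j hij h
    have hi := h.mem_left
    have hj := h.mem_right
    refine rel_krew_of_lt (π.subset hB hi) (π.subset hB hj) hij fun u v huv hiu huj => ?_
    by_cases hu : u ∈ B
    · rw [rel_bind_of_mem hB hu] at huv
      have := (rel_krew.1 h).2.2 u v huv
      grind
    · have hij' : π.Rel i j := ⟨B, hB, hi, hj⟩
      have huv := le_iff_rel.1 (bind_le Q) _ _ huv
      have hiu' : ¬ π.Rel i u := fun h => hu ((rel_iff_mem_of_mem_parts hB hi).1 h)
      have huj : u < j := lt_of_le_of_ne huj (by rintro rfl; exact hu hj)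
      constructor
      · by_contra! hvi
        rcases hvi.lt_or_eq with hvi | rfl
        · exact hiu' (hπ hvi hiu huj huv.symm hij').symm
        · exact hiu' huv.symm
      · by_contra! hjv
        exact hiu' (hij'.trans (hπ hiu huj hjv hij' huv))
  refine eq_of_rel_iff fun i j => ?_
  rw [rel_inf, rel_bind]
  constructor
  · rintro ⟨B, hB, h⟩
    refine ⟨⟨B, hB, h.mem_left, h.mem_right⟩, ?_⟩
    rcases lt_trichotomy i j with hl | rfl | hl
    · exact key hB hl h
    · exact rel_refl (π.subset hB h.mem_left)
    · exact (key hB hl h.symm).symm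
  · rintro ⟨⟨B, hB, hi, hj⟩, h⟩
    refine ⟨B, hB, rel_krew.2 ⟨hi, hj, fun x y hxy => ?_⟩⟩
    exact (rel_krew.1 h).2.2 x y (rel_bind.2 ⟨B, hB, hxy⟩)

theorem prod_bind {R : Type*} [CommMonoid R] (F : Finset α → R)
    (Q : ∀ B ∈ π.parts, Finpartition B) :
    ∏ V ∈ (π.bind Q).parts, F V = ∏ B ∈ π.parts.attach, ∏ V ∈ (Q B.1 B.2).parts, F V := by
  rw [bind_parts, Finset.prod_biUnion]
  rintro ⟨B, hB⟩ - ⟨C, hC⟩ - hBC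
  rw [Function.onFun, Finset.disjoint_left]
  rintro V hVB hVC
  obtain ⟨x, hx⟩ := (Q B hB).nonempty_of_mem_parts hVB
  exact hBC (Subtype.ext (π.eq_of_mem_parts hB hC ((Q B hB).subset hVB hx)
    ((Q C hC).subset hVC hx)))

end Bind
end Finpartition

section BoxOn

open Finpartition

variable {α : Type*} [LinearOrder α] {R : Type*} [CommRing R]

open Classical in
/-- Boxed convolution of functions on the finite subsets of a linear order. For the function
`V ↦ f (w|V)` on sets of positions of a word `w` it computes the boxed convolution of series at all
subwords of `w` at once. -/
noncomputable def boxOn (F G : Finset α → R) (S : Finset α) : R :=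
  ∑ π : Finpartition S with π.IsNonCrossing,
    (∏ V ∈ π.parts, F V) * ∏ V ∈ π.krew.parts, G V

open Classical in
/-- The product of a boxed convolution over the blocks of a non-crossing partition `π` is the sum over
the interval `[⊥, π]`, with relative complements. -/
theorem prod_boxOn (F G : Finset α → R) {S : Finset α} {π : Finpartition S}
    (hπ : π.IsNonCrossing) : ∏ B ∈ π.parts, boxOn F G B =
      ∑ ρ : Finpartition S with ρ.IsNonCrossing ∧ ρ ≤ π,
        (∏ V ∈ ρ.parts, F V) * ∏ V ∈ (π ⊓ ρ.krew).parts, G V := by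
  simp only [boxOn]
  rw [Finset.prod_sum]
  refine Finset.sum_bij (fun Q _ => π.bind Q) ?_ ?_ ?_ ?_
  · intro Q hQ
    simp only [Finset.mem_pi, Finset.mem_filter, Finset.mem_univ, true_and] at hQ ⊢
    exact ⟨hπ.bind hQ, bind_le Q⟩
  · intro Q _ Q' _ h
    funext B hB
    refine eq_of_rel_iff fun x y => ?_
    by_cases hx : x ∈ B
    · rw [← rel_bind_of_mem hB hx, ← rel_bind_of_mem hB hx, h]
    · exact ⟨fun h => absurd h.mem_left hx, fun h => absurd h.mem_left hx⟩
  · intro ρ hρ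
    simp only [Finset.mem_filter, Finset.mem_univ, true_and] at hρ
    refine ⟨fun B hB => ρ.restrict (π.le hB), ?_, bind_restrict hρ.2⟩
    simp only [Finset.mem_pi, Finset.mem_filter, Finset.mem_univ, true_and]
    intro B hB a b c d hab hbc hcd hac hbd
    rw [rel_restrict] at *
    exact ⟨hρ.1 hab hbc hcd hac.1 hbd.1, hac.2.2, hbd.2.1⟩
  · intro Q _
    rw [Finset.prod_mul_distrib, prod_bind, ← hπ.bind_krew, prod_bind]

/-- Both sides are sums over pairs: over `τ ≤ π` on the left and over `τ`, `ρ ≤ K(τ)` on the right. The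
substitution `ρ = π ⊓ K(τ)` turns one into the other. -/
theorem boxOn_assoc (F G H : Finset α → R) (S : Finset α) :
    boxOn (boxOn F G) H S = boxOn F (boxOn G H) S := by
  classical
  have hl : boxOn (boxOn F G) H S = ∑ π : Finpartition S with π.IsNonCrossing,
      ∑ τ : Finpartition S with τ.IsNonCrossing ∧ τ ≤ π, (∏ V ∈ τ.parts, F V) *
        ((∏ V ∈ (π ⊓ τ.krew).parts, G V) * ∏ V ∈ π.krew.parts, H V) := by
    rw [boxOn]
    refine Finset.sum_congr rfl fun π hπ => ?_
    rw [prod_boxOn F G (Finset.mem_filter.1 hπ).2, Finset.sum_mul]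
    exact Finset.sum_congr rfl fun τ _ => mul_assoc _ _ _
  have hr : boxOn F (boxOn G H) S = ∑ τ : Finpartition S with τ.IsNonCrossing,
      ∑ ρ : Finpartition S with ρ.IsNonCrossing ∧ ρ ≤ τ.krew, (∏ V ∈ τ.parts, F V) *
        ((∏ V ∈ ρ.parts, G V) * ∏ V ∈ (τ.krew ⊓ ρ.krew).parts, H V) := by
    rw [boxOn]
    refine Finset.sum_congr rfl fun τ _ => ?_
    rw [prod_boxOn G H (isNonCrossing_krew τ), Finset.mul_sum]
  rw [hl, hr, Finset.sum_comm' (s' := fun τ : Finpartition S =>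
    {π : Finpartition S | π.IsNonCrossing ∧ τ ≤ π}) (t' := {τ : Finpartition S | τ.IsNonCrossing})
    (by simp; tauto)]
  refine Finset.sum_congr rfl fun τ hτ => ?_
  replace hτ := (Finset.mem_filter.1 hτ).2
  refine Finset.sum_bij (fun π _ => π ⊓ τ.krew) ?_ ?_ ?_ ?_
  · intro π hπ
    simp only [Finset.mem_filter, Finset.mem_univ, true_and] at hπ ⊢
    exact ⟨hπ.1.inf (isNonCrossing_krew τ), inf_le_right⟩
  · intro π hπ σ hσ h
    simp only [Finset.mem_filter, Finset.mem_univ, true_and] at hπ hσ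
    exact hτ.eq_of_inf_krew_eq hπ.1 hσ.1 hπ.2 hσ.2 h
  · intro ρ hρ
    simp only [Finset.mem_filter, Finset.mem_univ, true_and] at hρ
    obtain ⟨π, h₁, h₂, h₃⟩ := hτ.exists_inf_krew_eq hρ.1 hρ.2
    exact ⟨π, by simp [h₁, h₂], h₃⟩
  · intro π hπ
    simp only [Finset.mem_filter, Finset.mem_univ, true_and] at hπ
    rw [← hτ.krew_eq_inf hπ.1 hπ.2]

end BoxOn

/-! ### Transport to words, and associativity for truncated series -/

namespace Finpartition

variable {α β : Type*} [LinearOrder α] [LinearOrder β] {S : Finset α}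

/-- The image of a partition under an order embedding. -/
def mapEmb (ι : α ↪o β) (π : Finpartition S) : Finpartition (S.map ι.toEmbedding) :=
  ofExistsUnique (π.parts.map (Finset.mapEmbedding ι.toEmbedding).toEmbedding)
    (by
      simp only [Finset.mem_map, forall_exists_index, and_imp]
      rintro _ B hB rfl
      exact Finset.map_subset_map.2 (π.subset hB))
    (by
      simp only [Finset.mem_map, forall_exists_index, and_imp]
      rintro _ a ha rfl
      obtain ⟨B, ⟨hB, haB⟩, huniq⟩ := π.existsUnique_mem ha
      refine ⟨B.map ι.toEmbedding, ⟨⟨B, hB, rfl⟩, Finset.mem_map_of_mem _ haB⟩, ?_⟩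
      rintro _ ⟨⟨C, hC, rfl⟩, hCa⟩
      exact congrArg _ (huniq C ⟨hC, (Finset.mem_map' _).1 hCa⟩))
    (by
      simp only [Finset.mem_map, not_exists, not_and]
      rintro B hB h
      exact π.ne_empty hB (Finset.map_eq_empty.1 h))

theorem prod_mapEmb {R : Type*} [CommMonoid R] (ι : α ↪o β) (π : Finpartition S)
    (F : Finset β → R) :
    ∏ V ∈ (π.mapEmb ι).parts, F V = ∏ V ∈ π.parts, F (V.map ι.toEmbedding) :=
  Finset.prod_map _ _ _

theorem rel_mapEmb {ι : α ↪o β} {π : Finpartition S} {a b : α} :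
    (π.mapEmb ι).Rel (ι a) (ι b) ↔ π.Rel a b := by
  constructor
  · rintro ⟨_, hB, ha, hb⟩
    obtain ⟨B, hB', rfl⟩ := Finset.mem_map.1 hB
    exact ⟨B, hB', (Finset.mem_map' _).1 ha, (Finset.mem_map' _).1 hb⟩
  · rintro ⟨B, hB, ha, hb⟩
    exact ⟨B.map ι.toEmbedding, Finset.mem_map.2 ⟨B, hB, rfl⟩, Finset.mem_map_of_mem _ ha,
      Finset.mem_map_of_mem _ hb⟩

/-- Partitions of an image are determined by the relation on the source. -/
theorem eq_of_rel_map_iff {ι : α ↪o β} {π σ : Finpartition (S.map ι.toEmbedding)}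
    (h : ∀ a ∈ S, ∀ b ∈ S, π.Rel (ι a) (ι b) ↔ σ.Rel (ι a) (ι b)) : π = σ := by
  refine eq_of_rel_iff fun x y => ⟨fun hxy => ?_, fun hxy => ?_⟩ <;>
  · obtain ⟨a, ha, rfl⟩ := Finset.mem_map.1 hxy.mem_left
    obtain ⟨b, hb, rfl⟩ := Finset.mem_map.1 hxy.mem_right
    first | exact (h a ha b hb).1 hxy | exact (h a ha b hb).2 hxy

theorem isNonCrossing_mapEmb {ι : α ↪o β} {π : Finpartition S} :
    (π.mapEmb ι).IsNonCrossing ↔ π.IsNonCrossing := by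
  constructor
  · intro h a b c d hab hbc hcd hac hbd
    exact rel_mapEmb.1 (h (ι.lt_iff_lt.2 hab) (ι.lt_iff_lt.2 hbc) (ι.lt_iff_lt.2 hcd)
      (rel_mapEmb.2 hac) (rel_mapEmb.2 hbd))
  · intro h a b c d hab hbc hcd hac hbd
    obtain ⟨a, -, rfl⟩ := Finset.mem_map.1 hac.mem_left
    obtain ⟨c, -, rfl⟩ := Finset.mem_map.1 hac.mem_right
    obtain ⟨b, -, rfl⟩ := Finset.mem_map.1 hbd.mem_left
    obtain ⟨d, -, rfl⟩ := Finset.mem_map.1 hbd.mem_right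
    exact rel_mapEmb.2 (h (ι.lt_iff_lt.1 hab) (ι.lt_iff_lt.1 hbc) (ι.lt_iff_lt.1 hcd)
      (rel_mapEmb.1 hac) (rel_mapEmb.1 hbd))

theorem krew_mapEmb (ι : α ↪o β) (π : Finpartition S) :
    (π.mapEmb ι).krew = π.krew.mapEmb ι := by
  refine eq_of_rel_map_iff fun i hi j hj => ?_
  rw [rel_mapEmb, rel_krew, rel_krew]
  constructor
  · rintro ⟨-, -, h⟩
    refine ⟨hi, hj, fun x y hxy => ?_⟩
    have := h (ι x) (ι y) (rel_mapEmb.2 hxy)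
    simpa only [ι.le_iff_le] using this
  · rintro ⟨-, -, h⟩
    refine ⟨Finset.mem_map_of_mem _ hi, Finset.mem_map_of_mem _ hj, fun x y hxy => ?_⟩
    obtain ⟨x, -, rfl⟩ := Finset.mem_map.1 hxy.mem_left
    obtain ⟨y, -, rfl⟩ := Finset.mem_map.1 hxy.mem_right
    have := h x y (rel_mapEmb.1 hxy)
    simpa only [RelEmbedding.coe_toEmbedding, ι.le_iff_le] using this

theorem mapEmb_injective (ι : α ↪o β) :
    Function.Injective (mapEmb ι : Finpartition S → Finpartition (S.map ι.toEmbedding)) :=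
  fun π σ h => eq_of_rel_iff fun a b => by rw [← rel_mapEmb (ι := ι), h, rel_mapEmb]

theorem mapEmb_surjective (ι : α ↪o β) :
    Function.Surjective (mapEmb ι : Finpartition S → Finpartition (S.map ι.toEmbedding)) := by
  classical
  intro σ
  refine ⟨ofSetSetoid ((Setoid.ker fun a : α => σ.part (ι a))) S, ?_⟩
  refine eq_of_rel_map_iff fun a ha b hb => ?_
  have := σ.mem_part_iff_part_eq_part (Finset.mem_map_of_mem ι.toEmbedding hb)
    (Finset.mem_map_of_mem ι.toEmbedding ha)
  rw [rel_mapEmb, rel_ofSetSetoid, rel_iff_mem_part, Setoid.ker_def]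
  exact ⟨fun h => this.2 h.2.2.symm, fun h => ⟨ha, hb, (this.1 h).symm⟩⟩

end Finpartition

section Transport

open Finpartition

variable {R : Type*} [CommRing R]

theorem boxOn_map {α β : Type*} [LinearOrder α] [LinearOrder β] (ι : α ↪o β)
    (F G : Finset β → R) (S : Finset α) :
    boxOn F G (S.map ι.toEmbedding) =
      boxOn (fun V => F (V.map ι.toEmbedding)) (fun V => G (V.map ι.toEmbedding)) S := by
  classical
  symm
  refine Finset.sum_bij (fun π _ => π.mapEmb ι) ?_ ?_ ?_ ?_
  · intro π hπ
    simpa [isNonCrossing_mapEmb] using hπ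
  · exact fun π _ σ _ h => mapEmb_injective ι h
  · intro σ hσ
    obtain ⟨π, rfl⟩ := mapEmb_surjective ι σ
    exact ⟨π, by simpa [isNonCrossing_mapEmb] using hσ, rfl⟩
  · intro π _
    rw [prod_mapEmb, krew_mapEmb, prod_mapEmb]

theorem boxOn_congr {α : Type*} [LinearOrder α] {F F' G G' : Finset α → R} {S : Finset α}
    (hF : ∀ V ⊆ S, V.Nonempty → F V = F' V) (hG : ∀ V ⊆ S, V.Nonempty → G V = G' V) :
    boxOn F G S = boxOn F' G' S := by
  refine Finset.sum_congr rfl fun π _ => congrArg₂ _ ?_ ?_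
  · exact Finset.prod_congr rfl fun V hV => hF V (π.subset hV) (π.nonempty_of_mem_parts hV)
  · exact Finset.prod_congr rfl fun V hV => hG V (π.krew.subset hV) (nonempty_of_mem_parts _ hV)

variable {s n : ℕ}

theorem wordRestrict_eq_map_sort (w : List (Fin s)) (V : Finset (Fin w.length)) :
    wordRestrict w V = V.sort.map w.get := by
  have hnd : ((List.finRange w.length).filter (· ∈ V)).Nodup := (List.nodup_finRange _).filter _
  have hV : ((List.finRange w.length).filter (· ∈ V)).toFinset = V := by
    ext
    simp
  have hs : ((List.finRange w.length).filter (· ∈ V)).Pairwise (· ≤ ·) :=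
    ((List.pairwise_lt_finRange _).imp le_of_lt).filter _
  have := (List.toFinset_sort (· ≤ ·) hnd).2 hs
  rw [hV] at this
  rw [wordRestrict, this]

theorem length_wordRestrict (w : List (Fin s)) (V : Finset (Fin w.length)) :
    (wordRestrict w V).length = V.card := by
  simp [wordRestrict_eq_map_sort]

theorem wordRestrict_univ (w : List (Fin s)) : wordRestrict w Finset.univ = w := by
  simp [wordRestrict]

theorem wordRestrict_wordRestrict (w : List (Fin s)) (V : Finset (Fin w.length))
    (U : Finset (Fin (wordRestrict w V).length)) :
    wordRestrict (wordRestrict w V) U =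
      wordRestrict w (U.map (V.orderEmbOfFin (length_wordRestrict w V).symm).toEmbedding) := by
  rw [wordRestrict_eq_map_sort, wordRestrict_eq_map_sort w (Finset.map _ _),
    ← StrictMonoOn.map_finsetSort, List.map_map]
  · refine List.map_congr_left fun i _ => ?_
    have := wordRestrict_eq_map_sort w V
    simp [Finset.orderEmbOfFin_apply, this]
  · exact (OrderEmbedding.strictMono _).strictMonoOn _

theorem rel_iff_setPartitionRel {m : ℕ} {π : SetPartition m} {i j : Fin m} :
    Finpartition.Rel π i j ↔ SetPartition.Rel π i j := by
  rw [rel_iff_mem_part, SetPartition.Rel,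
    mem_part_iff_part_eq_part _ (Finset.mem_univ _) (Finset.mem_univ _), eq_comm]

theorem isNonCrossing_iff {m : ℕ} {π : SetPartition m} : π.IsNonCrossing ↔ π.NonCrossing := by
  have : Finpartition.Rel π = SetPartition.Rel π := by
    funext i j
    exact propext rel_iff_setPartitionRel
  rw [IsNonCrossing, this, SetPartition.NonCrossing]

theorem kreweras_eq_krew {m : ℕ} (π : SetPartition m) : π.kreweras = π.krew := by
  refine eq_of_rel_iff fun i j => ?_
  rw [rel_iff_setPartitionRel, SetPartition.rel_kreweras, rel_krew]
  simp [rel_iff_setPartitionRel]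

theorem boxCoeff_eq_boxOn (f g : List (Fin s) → R) (w : List (Fin s)) :
    boxCoeff f g w =
      boxOn (fun V => f (wordRestrict w V)) (fun V => g (wordRestrict w V)) Finset.univ := by
  classical
  rw [boxCoeff, boxOn]
  refine Finset.sum_congr (Finset.filter_congr fun π _ => isNonCrossing_iff.symm) fun π _ => ?_
  rw [coeffPartition, coeffPartition, kreweras_eq_krew]

theorem boxCoeff_wordRestrict (f g : List (Fin s) → R) (w : List (Fin s))
    (V : Finset (Fin w.length)) : boxCoeff f g (wordRestrict w V) =
      boxOn (fun U => f (wordRestrict w U)) (fun U => g (wordRestrict w U)) V := by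
  rw [boxCoeff_eq_boxOn]
  simp only [wordRestrict_wordRestrict]
  rw [← boxOn_map (V.orderEmbOfFin (length_wordRestrict w V).symm)
    (fun U => f (wordRestrict w U)) (fun U => g (wordRestrict w U)),
    Finset.map_orderEmbOfFin_univ]

theorem TruncSeries.coeff_of_le (f : TruncSeries s n R) {w : List (Fin s)}
    (h : 1 ≤ w.length ∧ w.length ≤ n) : f.coeff w = f ⟨w, h⟩ := dif_pos h

theorem TruncSeries.coeff_box_wordRestrict (f g : TruncSeries s n R) (w : TruncWord s n)
    {V : Finset (Fin w.1.length)} (hV : V.Nonempty) :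
    (f.box g).coeff (wordRestrict w.1 V) =
      boxOn (fun U => f.coeff (wordRestrict w.1 U)) (fun U => g.coeff (wordRestrict w.1 U)) V := by
  rw [coeff_of_le _ ⟨?_, ?_⟩, box, boxCoeff_wordRestrict]
  · rw [length_wordRestrict]
    exact hV.card_pos
  · rw [length_wordRestrict]
    exact (Finset.card_le_univ V).trans (by simpa using w.2.2)

theorem TruncSeries.box_assoc (f g h : TruncSeries s n R) :
    (f.box g).box h = f.box (g.box h) := by
  funext w
  rw [box, box, boxCoeff_eq_boxOn, boxCoeff_eq_boxOn,
    boxOn_congr (fun V _ hV => f.coeff_box_wordRestrict g w hV) fun _ _ _ => rfl, boxOn_assoc]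
  exact boxOn_congr (fun _ _ _ => rfl) fun V _ hV => (g.coeff_box_wordRestrict h w hV).symm

end Transport

/-! ### The unit, and left inverses -/

section Extremal

open Finpartition

variable {α : Type*} [LinearOrder α] {R : Type*} [CommRing R] {S : Finset α}

namespace Finpartition

theorem isNonCrossing_bot : (⊥ : Finpartition S).IsNonCrossing := by
  intro a b c d hab hbc _ hac _
  exact absurd (rel_bot.1 hac).2 (hab.trans hbc).ne

theorem isNonCrossing_top : (⊤ : Finpartition S).IsNonCrossing :=
  fun _ _ _ _ _ _ _ hac hbd => rel_top hac.mem_right hbd.mem_left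

theorem krew_bot : (⊥ : Finpartition S).krew = ⊤ := by
  refine eq_of_rel_iff fun i j => ⟨fun h => rel_top h.mem_left h.mem_right, fun h => ?_⟩
  refine rel_krew.2 ⟨h.mem_left, h.mem_right, fun x y hxy => ?_⟩
  rw [(rel_bot.1 hxy).2]

theorem krew_top : (⊤ : Finpartition S).krew = ⊥ := by
  refine eq_of_rel_iff fun i j => ⟨fun h => rel_bot.2 ⟨h.mem_left, ?_⟩, fun h => ?_⟩
  · have := (rel_krew.1 h).2.2 i j (rel_top h.mem_left h.mem_right)
    grind
  · obtain ⟨hi, rfl⟩ := rel_bot.1 h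
    exact rel_refl hi

theorem parts_top (hS : S.Nonempty) : (⊤ : Finpartition S).parts = {S} := by
  have h := parts_top_subset S
  obtain ⟨V, hV⟩ := (⊤ : Finpartition S).parts_nonempty hS.ne_empty
  refine Finset.Subset.antisymm h (Finset.singleton_subset_iff.2 ?_)
  have hVS := Finset.mem_singleton.1 (h hV)
  rwa [hVS] at hV

theorem prod_parts_bot {M : Type*} [CommMonoid M] (F : Finset α → M) :
    ∏ V ∈ (⊥ : Finpartition S).parts, F V = ∏ x ∈ S, F {x} := by
  rw [parts_bot, Finset.prod_map]
  rfl

theorem eq_top_of_mem_parts {π : Finpartition S} (h : S ∈ π.parts) : π = ⊤ :=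
  le_antisymm le_top (le_iff_rel.2 fun _ _ hxy => ⟨S, h, hxy.mem_left, hxy.mem_right⟩)

theorem eq_bot_of_card_eq_one {π : Finpartition S} (h : ∀ V ∈ π.parts, V.card = 1) : π = ⊥ := by
  refine le_antisymm (le_iff_rel.2 fun x y hxy => ?_) bot_le
  obtain ⟨V, hV, hx, hy⟩ := hxy
  exact rel_bot.2 ⟨π.subset hV hx, Finset.card_le_one.1 (h V hV).le x hx y hy⟩

theorem one_lt_card_parts {π : Finpartition S} (hS : S.Nonempty) (h : π ≠ ⊤) :
    1 < π.parts.card := by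
  by_contra! hle
  obtain ⟨V, hV⟩ := π.parts_nonempty hS.ne_empty
  have hpar : π.parts = {V} :=
    Finset.eq_singleton_iff_unique_mem.2 ⟨hV, fun U hU => Finset.card_le_one.1 hle U hU V hV⟩
  have := π.sup_parts
  rw [hpar, Finset.sup_singleton, id] at this
  exact h (eq_top_of_mem_parts (this ▸ hV))

end Finpartition

/-- The function which is `1` on singletons and `0` elsewhere is a left unit. -/
theorem boxOn_delta_left (G : Finset α → R) (hS : S.Nonempty) :
    boxOn (fun V => if V.card = 1 then 1 else 0) G S = G S := by
  classical
  rw [boxOn, Finset.sum_eq_single (⊥ : Finpartition S)]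
  · rw [krew_bot, parts_top hS, prod_parts_bot]
    simp
  · intro π _ hπ
    obtain ⟨V, hV, hne⟩ : ∃ V ∈ π.parts, V.card ≠ 1 := by
      by_contra! h
      exact hπ (eq_bot_of_card_eq_one h)
    rw [Finset.prod_eq_zero hV (if_neg hne), zero_mul]
  · exact fun h => absurd (by simp [isNonCrossing_bot]) h

open Classical in
/-- The summand of the one-block partition, whose Kreweras complement consists of singletons, split
off from a boxed convolution. -/
theorem boxOn_eq_top_add (F G : Finset α → R) (hS : S.Nonempty) :
    boxOn F G S = F S * ∏ x ∈ S, G {x} +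
      ∑ π : Finpartition S with π.IsNonCrossing ∧ π ≠ ⊤,
        (∏ V ∈ π.parts, F V) * ∏ V ∈ π.krew.parts, G V := by
  have hmem : (⊤ : Finpartition S) ∈
      ({π | π.IsNonCrossing} : Finset (Finpartition S)) := by simp [isNonCrossing_top]
  rw [boxOn, ← Finset.add_sum_erase _ _ hmem, krew_top, parts_top hS, prod_parts_bot,
    Finset.prod_singleton]
  refine congrArg _ (Finset.sum_congr ?_ fun _ _ => rfl)
  ext π
  simp [and_comm]

end Extremal

namespace TruncSeries

open Finpartition

variable {s n : ℕ} {R : Type*} [CommRing R]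

/-- The unit `∑ z_i` of boxed convolution. -/
def delta (s n : ℕ) (R : Type*) [CommRing R] : TruncSeries s n R :=
  fun w => if w.1.length = 1 then 1 else 0

/-- The product of the coefficients of `g` at the letters of the word `w`. -/
def letterProd (g : TruncSeries s n R) (w : TruncWord s n) : R :=
  ∏ x : Fin w.1.length, g.coeff [w.1.get x]

theorem wordRestrict_singleton (w : List (Fin s)) (x : Fin w.length) :
    wordRestrict w {x} = [w.get x] := by
  simp [wordRestrict_eq_map_sort]

theorem univ_nonempty (w : TruncWord s n) :
    (Finset.univ : Finset (Fin w.1.length)).Nonempty :=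
  ⟨⟨0, w.2.1⟩, Finset.mem_univ _⟩

theorem card_le (w : TruncWord s n) (V : Finset (Fin w.1.length)) : V.card ≤ w.1.length := by
  simpa using Finset.card_le_univ V

theorem coeff_wordRestrict (f : TruncSeries s n R) (w : TruncWord s n)
    {V : Finset (Fin w.1.length)} (hV : V.Nonempty) :
    ∃ u : TruncWord s n, u.1.length = V.card ∧ u.1 = wordRestrict w.1 V ∧
      f.coeff (wordRestrict w.1 V) = f u := by
  have h : 1 ≤ (wordRestrict w.1 V).length ∧ (wordRestrict w.1 V).length ≤ n := by
    rw [length_wordRestrict]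
    exact ⟨hV.card_pos, (card_le w V).trans w.2.2⟩
  exact ⟨⟨_, h⟩, length_wordRestrict _ _, rfl, f.coeff_of_le h⟩

theorem box_apply (f g : TruncSeries s n R) (w : TruncWord s n) :
    f.box g w = boxOn (fun V => f.coeff (wordRestrict w.1 V))
      (fun V => g.coeff (wordRestrict w.1 V)) Finset.univ := by
  rw [box, boxCoeff_eq_boxOn]

open Classical in
theorem box_apply_eq_add (f g : TruncSeries s n R) (w : TruncWord s n) :
    f.box g w = f w * g.letterProd w +
      ∑ π : Finpartition (Finset.univ : Finset (Fin w.1.length)) with π.IsNonCrossing ∧ π ≠ ⊤,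
        (∏ V ∈ π.parts, f.coeff (wordRestrict w.1 V)) *
          ∏ V ∈ π.krew.parts, g.coeff (wordRestrict w.1 V) := by
  rw [box_apply, boxOn_eq_top_add _ _ (univ_nonempty w), wordRestrict_univ, f.coeff_of_le w.2,
    letterProd]
  simp only [wordRestrict_singleton]

theorem delta_box (g : TruncSeries s n R) : (delta s n R).box g = g := by
  funext w
  have h : ∀ V ⊆ (Finset.univ : Finset (Fin w.1.length)), V.Nonempty →
      (delta s n R).coeff (wordRestrict w.1 V) = if V.card = 1 then 1 else 0 := by
    intro V _ hV
    obtain ⟨u, hu, -, h⟩ := (delta s n R).coeff_wordRestrict w hV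
    rw [h, delta, hu]
  rw [box_apply, boxOn_congr h fun _ _ _ => rfl, boxOn_delta_left _ (univ_nonempty w),
    wordRestrict_univ, g.coeff_of_le w.2]

theorem letterProd_eq_prod (hn : 1 ≤ n) (g : TruncSeries s n R) (w : TruncWord s n) :
    g.letterProd w =
      ∏ x : Fin w.1.length, g ⟨[w.1.get x], by simpa using hn⟩ :=
  Finset.prod_congr rfl fun _ _ => g.coeff_of_le _

theorem letterProd_of_length_eq_one (g : TruncSeries s n R) {w : TruncWord s n}
    (hw : w.1.length = 1) : g.letterProd w = g w := by
  obtain ⟨w, h⟩ := w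
  obtain ⟨i, rfl⟩ := List.length_eq_one_iff.1 hw
  have : g.letterProd ⟨[i], h⟩ = g.coeff [i] := by
    simp [letterProd]
  rw [this, g.coeff_of_le h]

theorem isUnit_letterProd (hn : 1 ≤ n) {g : TruncSeries s n R}
    (hg : ∀ w : TruncWord s n, w.1.length = 1 → IsUnit (g w)) (w : TruncWord s n) :
    IsUnit (g.letterProd w) := by
  rw [letterProd_eq_prod hn]
  exact IsUnit.prod_univ_iff.2 fun x => hg _ rfl

theorem letterProd_eq_one (hn : 1 ≤ n) {g : TruncSeries s n R}
    (hg : ∀ w : TruncWord s n, w.1.length = 1 → g w = 1) (w : TruncWord s n) :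
    g.letterProd w = 1 := by
  rw [letterProd_eq_prod hn]
  exact Finset.prod_eq_one fun x _ => hg _ rfl

theorem coeff_congr {f f' : TruncSeries s n R} {j : ℕ}
    (h : ∀ w : TruncWord s n, w.1.length ≤ j → f w = f' w) (w : TruncWord s n)
    {V : Finset (Fin w.1.length)} (hV : V.Nonempty) (hVj : V.card ≤ j) :
    f.coeff (wordRestrict w.1 V) = f'.coeff (wordRestrict w.1 V) := by
  obtain ⟨u, hu, hu', hf⟩ := f.coeff_wordRestrict w hV
  rw [hf, h u (hu ▸ hVj), ← hu', f'.coeff_of_le u.2]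

/-- A series with invertible letter coefficients has a left inverse. Its coefficients are found by
recursion on the length of words: the coefficient at `w` occurs in the equation for `w` only in the
summand of the one-block partition, multiplied by a unit. -/
theorem exists_box_eq_delta (hn : 1 ≤ n) {g : TruncSeries s n R}
    (hg : ∀ w : TruncWord s n, w.1.length = 1 → IsUnit (g w)) :
    ∃ f : TruncSeries s n R, f.box g = delta s n R := by
  classical
  suffices key : ∀ j : ℕ, ∃ f : TruncSeries s n R,
      ∀ w : TruncWord s n, w.1.length ≤ j → f.box g w = delta s n R w by
    obtain ⟨f, hf⟩ := key n
    exact ⟨f, funext fun w => hf w w.2.2⟩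
  intro j
  induction j with
  | zero => exact ⟨0, fun w hw => absurd w.2.1 (by omega)⟩
  | succ j ih =>
    obtain ⟨f, hf⟩ := ih
    let f' : TruncSeries s n R := fun w => if w.1.length ≤ j then f w else
      f w + Ring.inverse (g.letterProd w) * (delta s n R w - f.box g w)
    have hff' : ∀ w : TruncWord s n, w.1.length ≤ j → f' w = f w := fun w hw => if_pos hw
    refine ⟨f', fun w hw => ?_⟩
    by_cases hwj : w.1.length ≤ j
    · rw [← hf w hwj, box_apply, box_apply]
      exact boxOn_congr (fun V _ hV => coeff_congr hff' w hV ((card_le w V).trans hwj))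
        fun _ _ _ => rfl
    · have hsum := f.box_apply_eq_add g w
      rw [box_apply_eq_add, Finset.sum_congr rfl fun π hπ => congrArg₂ _
        (Finset.prod_congr rfl fun V hV => coeff_congr hff' w (π.nonempty_of_mem_parts hV) ?_) rfl]
      · have hinv := Ring.mul_inverse_cancel _ (isUnit_letterProd hn hg w)
        have hfw : f' w = f w + Ring.inverse (g.letterProd w) * (delta s n R w - f.box g w) :=
          if_neg hwj
        rw [hfw]
        linear_combination (delta s n R w - f.box g w) * hinv - hsum
      · simp only [Finset.mem_filter, Finset.mem_univ, true_and] at hπ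
        have hlt : V.card < w.1.length := by
          refine lt_of_le_of_ne (card_le w V) fun h => hπ.2 (eq_top_of_mem_parts ?_)
          have hVu := (Finset.card_eq_iff_eq_univ V).1 (by simpa using h)
          rwa [hVu] at hV
        omega

theorem map_coeff {R' F : Type*} [CommRing R'] [FunLike F R R'] [RingHomClass F R R'] (φ : F)
    (f : TruncSeries s n R) (w : List (Fin s)) :
    φ (f.coeff w) = TruncSeries.coeff (fun u => φ (f u) : TruncSeries s n R') w := by
  rw [coeff, coeff]
  split_ifs
  · rfl
  · exact map_zero φ

theorem map_box {R' F : Type*} [CommRing R'] [FunLike F R R'] [RingHomClass F R R'] (φ : F)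
    (f g : TruncSeries s n R) (w : TruncWord s n) :
    φ (f.box g w) =
      TruncSeries.box (fun u => φ (f u)) (fun u => φ (g u) : TruncSeries s n R') w := by
  simp only [box, boxCoeff, coeffPartition, map_sum, map_mul, map_prod, map_coeff]

end TruncSeries

/-! ### The action on polynomial functions -/

namespace TruncSeries

open Finpartition MvPolynomial

variable {s n : ℕ} {R : Type*} [CommRing R]

/-- The action of a series `g` on the polynomial functions in the coefficients of a series: the
algebra endomorphism which sends the coordinate `X_w` to the `w`-th coefficient of `X ⊠ g`, where `X` is
the generic series. -/
noncomputable def subst (g : TruncSeries s n R) :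
    MvPolynomial (TruncWord s n) R →ₐ[R] MvPolynomial (TruncWord s n) R :=
  aeval (TruncSeries.box (fun u => X u) (fun u => C (g u)))

theorem subst_X (g : TruncSeries s n R) (w : TruncWord s n) :
    subst g (X w) = TruncSeries.box (fun u => X u) (fun u => C (g u)) w := by
  rw [subst, aeval_X]

theorem subst_C (g : TruncSeries s n R) (r : R) : subst g (C r) = C r := by
  rw [← algebraMap_eq, AlgHom.commutes]

/-- The composite of the actions is given by the product, by associativity for the generic series
`X`: `(X ⊠ g) ⊠ h = X ⊠ (g ⊠ h)`. -/
theorem subst_comp_X (g h : TruncSeries s n R) (w : TruncWord s n) :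
    subst g (subst h (X w)) = subst (g.box h) (X w) := by
  have h₁ : (fun u : TruncWord s n => subst g (X u)) =
      TruncSeries.box (fun u => X u) (fun u => C (g u)) := by
    funext u
    rw [subst_X]
  have h₂ : (fun u : TruncWord s n => subst g (C (h u))) = fun u => C (h u) :=
    by funext u; rw [subst_C]
  have h₃ : (fun u : TruncWord s n => (C (g.box h u) : MvPolynomial (TruncWord s n) R)) =
      TruncSeries.box (fun u => C (g u)) (fun u => C (h u)) := by
    funext u
    rw [map_box]
  rw [subst_X h, subst_X (g.box h), map_box (subst g), h₁, h₂, h₃, box_assoc]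

theorem subst_comp (g h : TruncSeries s n R) (p : MvPolynomial (TruncWord s n) R) :
    subst g (subst h p) = subst (g.box h) p :=
  AlgHom.congr_fun (MvPolynomial.algHom_ext (f := (subst g).comp (subst h))
    fun w => subst_comp_X g h w) p

theorem aeval_delta_subst_X (g : TruncSeries s n R) (w : TruncWord s n) :
    aeval (delta s n R) (subst g (X w)) = g w := by
  rw [subst_X, map_box]
  have h₁ : (fun u => aeval (delta s n R) (X u : MvPolynomial (TruncWord s n) R)) = delta s n R :=
    funext fun u => aeval_X _ _
  have h₂ : (fun u => aeval (delta s n R) (C (g u) : MvPolynomial (TruncWord s n) R)) = g :=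
    funext fun u => by simp
  rw [h₁, h₂, delta_box]

theorem map_subst {R' : Type*} [CommRing R'] (φ : R →+* R') (g : TruncSeries s n R)
    (p : MvPolynomial (TruncWord s n) R) :
    map φ (subst g p) = subst (fun u => φ (g u)) (map φ p) := by
  have : (map φ).comp (subst g).toRingHom =
      (subst (fun u : TruncWord s n => φ (g u))).toRingHom.comp (map φ) := by
    refine MvPolynomial.ringHom_ext (fun r => ?_) fun w => ?_
    · simp [← algebraMap_eq]
    · simp only [RingHom.comp_apply, AlgHom.toRingHom_eq_coe, RingHom.coe_coe, map_X]
      rw [subst_X, subst_X, map_box]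
      simp only [map_X, map_C]
  exact RingHom.congr_fun this p

/-- The length of words, as a weight on the coordinates. -/
def wordWeight (w : TruncWord s n) : ℕ := w.1.length

theorem coeff_X (w : TruncWord s n) {V : Finset (Fin w.1.length)} (hV : V.Nonempty) :
    ∃ u : TruncWord s n, wordWeight u = V.card ∧
      TruncSeries.coeff (fun u => (X u : MvPolynomial (TruncWord s n) R)) (wordRestrict w.1 V) =
        X u := by
  obtain ⟨u, hu, -, h⟩ := TruncSeries.coeff_wordRestrict
    (fun u => (X u : MvPolynomial (TruncWord s n) R)) w hV
  exact ⟨u, hu, h⟩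

theorem coeff_C (g : TruncSeries s n R) (w : List (Fin s)) :
    TruncSeries.coeff (fun u => (C (g u) : MvPolynomial (TruncWord s n) R)) w =
      C (g.coeff w) := (map_coeff C g w).symm

/-- The action preserves weights, as the blocks of a partition of the positions of `w` have total
length `|w|`. -/
theorem isWeightedHomogeneous_subst_X (g : TruncSeries s n R) (w : TruncWord s n) :
    IsWeightedHomogeneous wordWeight (subst g (X w)) (wordWeight w) := by
  classical
  rw [subst_X, box_apply, boxOn]
  refine IsWeightedHomogeneous.sum _ _ _ fun π _ => ?_
  simp only [coeff_C]
  rw [← map_prod, ← add_zero (wordWeight w)]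
  refine IsWeightedHomogeneous.mul ?_ (isWeightedHomogeneous_C _ _)
  have hw : wordWeight w = ∑ V ∈ π.parts, V.card := by
    rw [π.sum_card_parts, Finset.card_univ, Fintype.card_fin, wordWeight]
  rw [hw]
  refine IsWeightedHomogeneous.prod _ _ _ fun V hV => ?_
  obtain ⟨u, hu, h⟩ := coeff_X (R := R) w (π.nonempty_of_mem_parts hV)
  rw [h, ← hu]
  exact isWeightedHomogeneous_X _ _ _

theorem isWeightedHomogeneous_subst_monomial (g : TruncSeries s n R) (m : TruncWord s n →₀ ℕ) :
    IsWeightedHomogeneous wordWeight (subst g (monomial m 1))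
      (Finsupp.weight wordWeight m) := by
  induction m using Finsupp.induction_linear with
  | zero =>
    rw [map_zero, ← C_apply, C_1, map_one]
    exact isWeightedHomogeneous_one _ _
  | add m m' h h' =>
    have hm : (monomial (m + m') 1 : MvPolynomial (TruncWord s n) R) =
        monomial m 1 * monomial m' 1 := by simp [monomial_mul]
    rw [hm, map_mul, map_add]
    exact h.mul h'
  | single w k =>
    rw [← X_pow_eq_monomial, map_pow, Finsupp.weight_single]
    exact (isWeightedHomogeneous_subst_X g w).pow k

/-- The eigenvalue of `g` on the monomial `m`. -/
noncomputable def diagCoeff (g : TruncSeries s n R) (m : TruncWord s n →₀ ℕ) : R :=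
  m.prod fun w k => g.letterProd w ^ k

/-- Only the one-block partition contributes a term of degree one to `(X ⊠ g)_w`. -/
theorem subst_X_sub_mem (g : TruncSeries s n R) (w : TruncWord s n) :
    subst g (X w) - C (g.letterProd w) * X w ∈ idealOfVars (TruncWord s n) R ^ 2 := by
  classical
  rw [subst_X, box_apply_eq_add]
  have hC : TruncSeries.letterProd (fun u => (C (g u) : MvPolynomial (TruncWord s n) R)) w =
      C (g.letterProd w) := by
    simp only [letterProd, coeff_C, map_prod]
  rw [hC, mul_comm (X w), add_sub_cancel_left]
  refine Ideal.sum_mem _ fun π hπ => Ideal.mul_mem_right _ _ ?_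
  simp only [Finset.mem_filter, Finset.mem_univ, true_and] at hπ
  refine Ideal.pow_le_pow_right (one_lt_card_parts (univ_nonempty w) hπ.2) ?_
  rw [← Finset.prod_const]
  refine Ideal.prod_mem_prod fun V hV => ?_
  obtain ⟨u, -, h⟩ := coeff_X (R := R) w (π.nonempty_of_mem_parts hV)
  rw [h]
  exact Ideal.subset_span ⟨u, rfl⟩

theorem monomial_mem (m : TruncWord s n →₀ ℕ) :
    (monomial m 1 : MvPolynomial (TruncWord s n) R) ∈
      idealOfVars (TruncWord s n) R ^ m.degree := by
  classical
  rw [mem_pow_idealOfVars_iff']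
  intro x hx
  rw [coeff_monomial, if_neg]
  rintro rfl
  exact lt_irrefl _ hx

/-- Leading terms with respect to the powers of an ideal multiply. -/
theorem sub_mem_pow_add {A : Type*} [CommRing A] {J : Ideal A} {a a' x x' c c' : A} {d d' : ℕ}
    (hx : x ∈ J ^ d) (hx' : x' ∈ J ^ d') (h : a - c * x ∈ J ^ (d + 1))
    (h' : a' - c' * x' ∈ J ^ (d' + 1)) : a * a' - c * c' * (x * x') ∈ J ^ (d + d' + 1) := by
  have ha' : a' ∈ J ^ d' := by
    have := add_mem (Ideal.pow_le_pow_right (Nat.le_succ d') h') (Ideal.mul_mem_left _ c' hx')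
    rwa [sub_add_cancel] at this
  have h₁ : (a - c * x) * a' ∈ J ^ (d + d' + 1) := by
    rw [show d + d' + 1 = (d + 1) + d' by ring, pow_add]
    exact Ideal.mul_mem_mul h ha'
  have h₂ : c * (x * (a' - c' * x')) ∈ J ^ (d + d' + 1) := by
    rw [add_assoc, pow_add]
    exact Ideal.mul_mem_left _ c (Ideal.mul_mem_mul hx h')
  have := add_mem h₁ h₂
  convert this using 1
  ring

theorem subst_monomial_sub_mem (g : TruncSeries s n R) (m : TruncWord s n →₀ ℕ) :
    subst g (monomial m 1) - C (g.diagCoeff m) * monomial m 1 ∈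
      idealOfVars (TruncWord s n) R ^ (m.degree + 1) := by
  induction m using Finsupp.induction_linear with
  | zero =>
    rw [diagCoeff, Finsupp.prod_zero_index, ← C_apply, C_1, map_one, mul_one, sub_self]
    exact zero_mem _
  | add m m' h h' =>
    have hm : (monomial (m + m') 1 : MvPolynomial (TruncWord s n) R) =
        monomial m 1 * monomial m' 1 := by simp [monomial_mul]
    have hd : g.diagCoeff (m + m') = g.diagCoeff m * g.diagCoeff m' :=
      Finsupp.prod_add_index' (fun _ => pow_zero _) fun _ _ _ => pow_add _ _ _
    rw [hm, hd, map_mul, map_add, C_mul]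
    exact sub_mem_pow_add (monomial_mem m) (monomial_mem m') h h'
  | single w k =>
    rw [diagCoeff, Finsupp.prod_single_index (h := fun w k => g.letterProd w ^ k) (pow_zero _), 
      ← X_pow_eq_monomial, Finsupp.degree_single]
    induction k with
    | zero => simp
    | succ k ih =>
      rw [pow_succ (X w : MvPolynomial (TruncWord s n) R), map_mul, pow_succ (g.letterProd w), C_mul]
      refine sub_mem_pow_add (d' := 1) ?_ ?_ ih (subst_X_sub_mem g w)
      · exact Ideal.pow_mem_pow (Ideal.subset_span (Set.mem_range_self w)) k
      · rw [pow_one]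
        exact Ideal.subset_span ⟨w, rfl⟩

/-- The action is triangular with respect to the degree of monomials. -/
theorem coeff_subst_monomial {m m' : TruncWord s n →₀ ℕ} (g : TruncSeries s n R)
    (h : m.degree ≤ m'.degree) :
    (subst g (monomial m' 1)).coeff m = if m = m' then g.diagCoeff m else 0 := by
  classical
  have := (mem_pow_idealOfVars_iff' _ _).1 (subst_monomial_sub_mem g m') m (Nat.lt_succ_of_le h)
  rw [coeff_sub, coeff_C_mul, coeff_monomial, sub_eq_zero] at this
  rw [this]
  split_ifs with h₁ h₂ h₂
  · rw [mul_one, h₁]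
  · exact absurd h₁.symm h₂
  · exact absurd h₂.symm h₁
  · rw [mul_zero]

end TruncSeries

/-! ### The matrix representation -/

section Index

variable (s n : ℕ)

open TruncSeries

/-- Monomials in the coordinates `X_w` of weight at most `n`, where `X_w` has weight `|w|`. -/
abbrev BoundedMonomial : Type :=
  {m : TruncWord s n →₀ ℕ // Finsupp.weight (wordWeight (s := s) (n := n)) m ≤ n}

instance : Finite (TruncWord s n) :=
  ((List.finite_length_le (Fin s) n).subset fun _ h => h.2).to_subtype

instance : Finite (BoundedMonomial s n) :=
  (Finsupp.finite_of_nat_weight_le wordWeight (fun w => Nat.one_le_iff_ne_zero.1 w.2.1) n).to_subtype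

/-- The number of monomials of weight at most `n`. -/
noncomputable def numMonomials : ℕ := Nat.card (BoundedMonomial s n)

theorem numMonomials_pos : 1 ≤ numMonomials s n := by
  have : Nonempty (BoundedMonomial s n) := ⟨⟨0, by simp⟩⟩
  exact Nat.card_pos

/-- The monomials can be numbered so that the degree decreases. -/
theorem exists_monomialEquiv : ∃ e : Fin (numMonomials s n) ≃ BoundedMonomial s n,
    ∀ i j, (e j).1.degree < (e i).1.degree → i < j := by
  let e := (Finite.equivFin (BoundedMonomial s n)).symm
  let d : Fin (numMonomials s n) → ℕᵒᵈ := fun i => OrderDual.toDual (e i).1.degree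
  refine ⟨(Tuple.sort d).trans e, fun i j hij => ?_⟩
  by_contra! hji
  exact absurd (Tuple.monotone_sort d hji) (not_le_of_gt hij)

/-- A numbering of the monomials of weight at most `n` by decreasing degree. -/
noncomputable def monomialEquiv : Fin (numMonomials s n) ≃ BoundedMonomial s n :=
  (exists_monomialEquiv s n).choose

variable {s n}

/-- The exponent of the `i`-th monomial. -/
noncomputable def expo (i : Fin (numMonomials s n)) : TruncWord s n →₀ ℕ := (monomialEquiv s n i).1

theorem lt_of_degree_lt {i j : Fin (numMonomials s n)} (h : (expo j).degree < (expo i).degree) :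
    i < j := (exists_monomialEquiv s n).choose_spec i j h

theorem expo_injective : Function.Injective (expo : Fin (numMonomials s n) → _) :=
  Subtype.val_injective.comp (monomialEquiv s n).injective

theorem weight_expo (i : Fin (numMonomials s n)) : Finsupp.weight wordWeight (expo i) ≤ n :=
  (monomialEquiv s n i).2

theorem exists_expo_eq {m : TruncWord s n →₀ ℕ} (hm : Finsupp.weight wordWeight m ≤ n) :
    ∃ i : Fin (numMonomials s n), expo i = m :=
  ⟨(monomialEquiv s n).symm ⟨m, hm⟩, by simp [expo]⟩

/-- The number of the monomial `X_w`. -/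
noncomputable def wordIndex (w : TruncWord s n) : Fin (numMonomials s n) :=
  (monomialEquiv s n).symm ⟨Finsupp.single w 1, by
    simpa [Finsupp.weight_single, wordWeight] using w.2.2⟩

theorem expo_wordIndex (w : TruncWord s n) : expo (wordIndex w) = Finsupp.single w 1 := by
  simp [expo, wordIndex]

end Index

namespace TruncSeries

open MvPolynomial

variable {s n : ℕ} {R : Type*} [CommRing R]

/-- A linear map on a polynomial of weight at most `n`, computed on monomials. -/
theorem apply_eq_sum_expo {M : Type*} [AddCommGroup M] [Module R M] {d : ℕ} (hd : d ≤ n)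
    {p : MvPolynomial (TruncWord s n) R} (hp : IsWeightedHomogeneous wordWeight p d)
    (L : MvPolynomial (TruncWord s n) R →ₗ[R] M) :
    L p = ∑ i : Fin (numMonomials s n), p.coeff (expo i) • L (monomial (expo i) 1) := by
  classical
  have hsub : p.support ⊆ Finset.univ.image (expo : Fin (numMonomials s n) → _) := by
    intro m hm
    obtain ⟨i, rfl⟩ := exists_expo_eq ((hp (mem_support_iff.1 hm)).trans_le hd)
    exact Finset.mem_image_of_mem _ (Finset.mem_univ _)
  conv_lhs => rw [p.as_sum, map_sum, Finset.sum_subset hsub (fun m _ hm => by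
    rw [notMem_support_iff.1 hm, map_zero, map_zero])]
  rw [Finset.sum_image fun i _ j _ h => expo_injective h]
  refine Finset.sum_congr rfl fun i _ => ?_
  rw [← map_smul, smul_monomial, smul_eq_mul, mul_one]

/-- The matrix of the action of `g` on the polynomials of weight at most `n`. -/
noncomputable def repMatrix (g : TruncSeries s n R) :
    Matrix (Fin (numMonomials s n)) (Fin (numMonomials s n)) R :=
  Matrix.of fun i j => (subst g (monomial (expo j) 1)).coeff (expo i)

theorem repMatrix_apply (g : TruncSeries s n R) (i j : Fin (numMonomials s n)) :
    repMatrix g i j = (subst g (monomial (expo j) 1)).coeff (expo i) := rfl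

/-- The action by right translation is a left action: the matrix of a product is the product of the
matrices, in the same order. -/
theorem repMatrix_box (g h : TruncSeries s n R) :
    repMatrix (g.box h) = repMatrix g * repMatrix h := by
  ext i j
  rw [Matrix.mul_apply, repMatrix_apply, ← subst_comp]
  have := apply_eq_sum_expo (weight_expo j) (isWeightedHomogeneous_subst_monomial h (expo j))
    ((lcoeff R (expo i)).comp (subst g).toLinearMap)
  simp only [LinearMap.comp_apply, AlgHom.toLinearMap_apply, lcoeff_apply, smul_eq_mul] at this
  rw [this]
  exact Finset.sum_congr rfl fun l _ => mul_comm _ _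

theorem repMatrix_of_lt (g : TruncSeries s n R) {i j : Fin (numMonomials s n)} (h : j < i) :
    repMatrix g i j = 0 := by
  have hd : (expo i).degree ≤ (expo j).degree := by
    by_contra! hlt
    exact absurd (lt_of_degree_lt hlt) h.asymm
  rw [repMatrix_apply, coeff_subst_monomial g hd, if_neg]
  exact fun he => h.ne' (expo_injective he)

theorem repMatrix_diag (g : TruncSeries s n R) (i : Fin (numMonomials s n)) :
    repMatrix g i i = g.diagCoeff (expo i) := by
  rw [repMatrix_apply, coeff_subst_monomial g le_rfl, if_pos rfl]

theorem isUpperTriangular_repMatrix (g : TruncSeries s n R) :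
    (repMatrix g).IsUpperTriangular := fun _ _ h => g.repMatrix_of_lt h

theorem map_repMatrix {R' : Type*} [CommRing R'] (φ : R →+* R') (g : TruncSeries s n R) :
    repMatrix (fun w => φ (g w)) = (repMatrix g).map φ := by
  ext i j
  rw [Matrix.map_apply, repMatrix_apply, repMatrix_apply, ← coeff_map, map_subst, map_monomial,
    map_one φ]

/-- The value of the monomial with exponent `m` at the unit `delta`. -/
noncomputable def deltaMonomial (R : Type*) [CommRing R] (m : TruncWord s n →₀ ℕ) : R :=
  m.prod fun w k => delta s n R w ^ k

theorem map_deltaMonomial {R' : Type*} [CommRing R'] (φ : R →+* R') (m : TruncWord s n →₀ ℕ) :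
    φ (deltaMonomial R m) = deltaMonomial R' m := by
  rw [deltaMonomial, deltaMonomial, map_finsuppProd]
  refine Finset.prod_congr rfl fun w _ => ?_
  simp only [delta, map_pow, apply_ite φ, map_one, map_zero]

/-- The series read off from a matrix: on `repMatrix g` it evaluates the function
`f ↦ (f ⊠ g)_w` at the unit. -/
noncomputable def ofMatrix (M : Matrix (Fin (numMonomials s n)) (Fin (numMonomials s n)) R) :
    TruncSeries s n R :=
  fun w => ∑ i, M i (wordIndex w) * deltaMonomial R (expo i)

theorem ofMatrix_repMatrix (g : TruncSeries s n R) : ofMatrix (repMatrix g) = g := by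
  funext w
  have := apply_eq_sum_expo w.2.2 (isWeightedHomogeneous_subst_X g w)
    (aeval (delta s n R)).toLinearMap
  simp only [AlgHom.toLinearMap_apply, aeval_delta_subst_X, aeval_monomial, map_one, one_mul,
    smul_eq_mul] at this
  rw [ofMatrix]
  simp only [repMatrix_apply, expo_wordIndex]
  exact this.symm

theorem map_ofMatrix {R' : Type*} [CommRing R'] (φ : R →+* R')
    (M : Matrix (Fin (numMonomials s n)) (Fin (numMonomials s n)) R) (w : TruncWord s n) :
    φ (ofMatrix M w) = ofMatrix (M.map φ) w := by
  simp only [ofMatrix, map_sum, map_mul, map_deltaMonomial, Matrix.map_apply]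

/-- The coefficients at words of length one are units. -/
def HasUnitLetters (f : TruncSeries s n R) : Prop :=
  ∀ w : TruncWord s n, w.1.length = 1 → IsUnit (f w)

/-- The coefficients at words of length one are `1`. -/
def HasOneLetters (f : TruncSeries s n R) : Prop :=
  ∀ w : TruncWord s n, w.1.length = 1 → f w = 1

theorem HasOneLetters.hasUnitLetters {f : TruncSeries s n R} (hf : f.HasOneLetters) :
    f.HasUnitLetters := fun w hw => hf w hw ▸ isUnit_one

theorem hasUnitLetters_of_isUnit {f : TruncSeries s n R} (hf : IsUnit (repMatrix f).det) :
    f.HasUnitLetters := by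
  intro w hw
  rw [Matrix.det_of_isUpperTriangular (isUpperTriangular_repMatrix f), IsUnit.prod_univ_iff] at hf
  have := hf (wordIndex w)
  rwa [repMatrix_diag, expo_wordIndex, diagCoeff, Finsupp.prod_single_index (h := fun w k =>
    f.letterProd w ^ k) (pow_zero _), pow_one, letterProd_of_length_eq_one f hw] at this

theorem HasUnitLetters.isUnit_det (hn : 1 ≤ n) {f : TruncSeries s n R} (hf : f.HasUnitLetters) :
    IsUnit (repMatrix f).det := by
  rw [Matrix.det_of_isUpperTriangular (isUpperTriangular_repMatrix f), IsUnit.prod_univ_iff]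
  intro i
  rw [repMatrix_diag]
  exact IsUnit.prod_iff.2 fun w _ => (isUnit_letterProd hn hf w).pow _

theorem HasOneLetters.repMatrix_diag_eq_one (hn : 1 ≤ n) {f : TruncSeries s n R}
    (hf : f.HasOneLetters) (i : Fin (numMonomials s n)) : repMatrix f i i = 1 := by
  rw [repMatrix_diag]
  refine Finset.prod_eq_one fun w _ => ?_
  change f.letterProd w ^ _ = 1
  rw [letterProd_eq_one hn hf, one_pow]

theorem repMatrix_delta (hn : 1 ≤ n) : repMatrix (delta s n R) = 1 := by
  have hu : IsUnit (repMatrix (delta s n R)) := by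
    refine (Matrix.isUnit_iff_isUnit_det _).2 (HasUnitLetters.isUnit_det hn fun w hw => ?_)
    simp [delta, hw]
  -- the matrix of `delta` is an invertible idempotent
  refine hu.mul_left_cancel ?_
  rw [← repMatrix_box, delta_box, mul_one]

/-- The faithful matrix representation of the series with invertible letter coefficients. -/
noncomputable def repGL (hn : 1 ≤ n) (f : TruncSeries s n R) (hf : f.HasUnitLetters) :
    GL (Fin (numMonomials s n)) R :=
  Matrix.GeneralLinearGroup.mk'' (repMatrix f) (hf.isUnit_det hn)

/-- For a matrix of the representation, the inverse belongs to a left inverse series. -/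
theorem exists_inv_eq_repMatrix (hn : 1 ≤ n) {M : GL (Fin (numMonomials s n)) R}
    {g : TruncSeries s n R} (hg : M.1 = repMatrix g) :
    ∃ f : TruncSeries s n R, f.box g = delta s n R ∧ (M⁻¹).1 = repMatrix f := by
  have hgu : g.HasUnitLetters :=
    hasUnitLetters_of_isUnit (hg ▸ (Matrix.isUnit_iff_isUnit_det _).1 M.isUnit)
  obtain ⟨f, hf⟩ := exists_box_eq_delta hn hgu
  refine ⟨f, hf, ?_⟩
  have h := repMatrix_box f g
  rw [hf, repMatrix_delta hn, ← hg] at h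
  exact (Units.inv_eq_of_mul_eq_one_left h.symm)

/-- The matrices representing the group `(𝔊ˢ)ₙ(R)`. That the letter coefficients of the series are
units need not be required: they occur on the diagonal of an invertible triangular matrix
(`hasUnitLetters_of_isUnit`). -/
noncomputable def repGroup (s : ℕ) (hn : 1 ≤ n) (R : Type*) [CommRing R] :
    Subgroup (GL (Fin (numMonomials s n)) R) where
  carrier := {M | ∃ f : TruncSeries s n R, M.1 = repMatrix f}
  one_mem' := ⟨delta s n R, (repMatrix_delta hn).symm⟩
  mul_mem' := by
    rintro A B ⟨f, hf⟩ ⟨g, hg⟩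
    exact ⟨f.box g, by rw [repMatrix_box, ← hf, ← hg]; rfl⟩
  inv_mem' := by
    rintro A ⟨g, hg⟩
    obtain ⟨f, -, hf⟩ := exists_inv_eq_repMatrix hn hg
    exact ⟨f, hf⟩

/-- The matrices representing the group `(𝔊ˢ₊)ₙ(R)`. -/
noncomputable def repGroupPlus (s : ℕ) (hn : 1 ≤ n) (R : Type*) [CommRing R] :
    Subgroup (GL (Fin (numMonomials s n)) R) where
  carrier := {M | ∃ f : TruncSeries s n R, f.HasOneLetters ∧ M.1 = repMatrix f}
  one_mem' := ⟨delta s n R, fun _ hw => if_pos hw, (repMatrix_delta hn).symm⟩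
  mul_mem' := by
    rintro A B ⟨f, hf', hf⟩ ⟨g, hg', hg⟩
    refine ⟨f.box g, fun w hw => ?_, by rw [repMatrix_box, ← hf, ← hg]; rfl⟩
    rw [box_letter _ _ w hw, hf' w hw, hg' w hw, mul_one]
  inv_mem' := by
    rintro A ⟨g, hg', hg⟩
    obtain ⟨f, hfg, hf⟩ := exists_inv_eq_repMatrix hn hg
    refine ⟨f, fun w hw => ?_, hf⟩
    have := congrFun hfg w
    rw [box_letter _ _ w hw, hg' w hw, mul_one] at this
    rw [this]
    exact if_pos hw

theorem repGroup_le (hn : 1 ≤ n) : repGroup s hn R ≤ borelGroup _ R := by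
  rintro M ⟨f, hf⟩ i j hij
  rw [hf]
  exact f.repMatrix_of_lt hij

theorem repGroupPlus_le (hn : 1 ≤ n) : repGroupPlus s hn R ≤ unipotentGroup _ R := by
  rintro M ⟨f, hf', hf⟩
  refine ⟨repGroup_le hn ⟨f, hf⟩, fun i => ?_⟩
  rw [hf]
  exact hf'.repMatrix_diag_eq_one hn i

/-- The isomorphism of `(𝔊ˢ)ₙ(R)` with a group of upper triangular matrices. -/
noncomputable def repEquiv (hn : 1 ≤ n) : TruncG s n R ≃* repGroup s hn R where
  toFun f := ⟨repGL hn f.1 f.2, f.1, rfl⟩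
  invFun M := ⟨ofMatrix M.1.1, by
    obtain ⟨M, f, hf⟩ := M
    change HasUnitLetters (ofMatrix M.1)
    have hu := (Matrix.isUnit_iff_isUnit_det _).1 M.isUnit
    rw [hf] at hu ⊢
    rw [ofMatrix_repMatrix]
    exact hasUnitLetters_of_isUnit hu⟩
  left_inv f := Subtype.ext (ofMatrix_repMatrix f.1)
  right_inv M := by
    obtain ⟨M, f, hf⟩ := M
    refine Subtype.ext (Units.ext ?_)
    change repMatrix (ofMatrix M.1) = M.1
    rw [hf, ofMatrix_repMatrix]
  map_mul' f g := Subtype.ext (Units.ext (repMatrix_box f.1 g.1))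

/-- The isomorphism of `(𝔊ˢ₊)ₙ(R)` with a group of unipotent matrices. -/
noncomputable def repPlusEquiv (hn : 1 ≤ n) : TruncGPlus s n R ≃* repGroupPlus s hn R where
  toFun f := ⟨repGL hn f.1 (HasOneLetters.hasUnitLetters f.2), f.1, f.2, rfl⟩
  invFun M := ⟨ofMatrix M.1.1, by
    obtain ⟨M, f, hf', hf⟩ := M
    change HasOneLetters (ofMatrix M.1)
    rwa [hf, ofMatrix_repMatrix]⟩
  left_inv f := Subtype.ext (ofMatrix_repMatrix f.1)
  right_inv M := by
    obtain ⟨M, f, -, hf⟩ := M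
    refine Subtype.ext (Units.ext ?_)
    change repMatrix (ofMatrix M.1) = M.1
    rw [hf, ofMatrix_repMatrix]
  map_mul' f g := Subtype.ext (Units.ext (repMatrix_box f.1 g.1))

section Closed

variable (s n) (k : Type*) [Field k]

/-- The generic matrix. -/
noncomputable def genericMatrix :
    Matrix (Fin (numMonomials s n)) (Fin (numMonomials s n))
      (MvPolynomial (Fin (numMonomials s n) × Fin (numMonomials s n)) k) :=
  Matrix.of fun i j => X (i, j)

/-- The equations saying that a matrix is represented by the series read off from it. -/
def repEquations : Set (MvPolynomial (Fin (numMonomials s n) × Fin (numMonomials s n)) k) :=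
  {p | ∃ i j, p = X (i, j) - repMatrix (ofMatrix (genericMatrix s n k)) i j}

/-- The equations saying that the series read off from a matrix has letter coefficients `1`. -/
def letterEquations : Set (MvPolynomial (Fin (numMonomials s n) × Fin (numMonomials s n)) k) :=
  {p | ∃ w : TruncWord s n, w.1.length = 1 ∧ p = ofMatrix (genericMatrix s n k) w - 1}

variable {s n k} {A : Type*} [CommRing A] [Algebra k A]
  (M : Matrix (Fin (numMonomials s n)) (Fin (numMonomials s n)) A)

/-- The specialization of the generic matrix to `M`. -/
noncomputable abbrev specialize :
    MvPolynomial (Fin (numMonomials s n) × Fin (numMonomials s n)) k →ₐ[k] A :=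
  aeval fun ij : Fin (numMonomials s n) × Fin (numMonomials s n) => M ij.1 ij.2

theorem specialize_ofMatrix (w : TruncWord s n) :
    specialize (k := k) M (ofMatrix (genericMatrix s n k) w) = ofMatrix M w := by
  have h := map_ofMatrix (specialize (k := k) M).toRingHom (genericMatrix s n k) w
  have hM : (genericMatrix s n k).map (specialize (k := k) M).toRingHom = M := by
    ext i j
    simp [genericMatrix]
  rwa [hM] at h

theorem specialize_repMatrix (i j : Fin (numMonomials s n)) :
    specialize (k := k) M (repMatrix (ofMatrix (genericMatrix s n k)) i j) =
      repMatrix (ofMatrix M) i j := by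
  have h := map_repMatrix (specialize (k := k) M).toRingHom (ofMatrix (genericMatrix s n k))
  have hM : (fun w => (specialize (k := k) M).toRingHom (ofMatrix (genericMatrix s n k) w)) =
      ofMatrix M := by
    funext w
    exact specialize_ofMatrix M w
  rw [hM] at h
  exact (congrFun (congrFun h i) j).symm

theorem forall_repEquations : (∀ p ∈ repEquations s n k, specialize M p = 0) ↔
    M = repMatrix (ofMatrix M) := by
  constructor
  · intro h
    ext i j
    have := h _ ⟨i, j, rfl⟩
    rwa [map_sub, specialize_repMatrix, aeval_X, sub_eq_zero] at this
  · rintro h _ ⟨i, j, rfl⟩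
    rw [map_sub, specialize_repMatrix, aeval_X, ← h, sub_self]

theorem forall_letterEquations : (∀ p ∈ letterEquations s n k, specialize M p = 0) ↔
    (ofMatrix M).HasOneLetters := by
  constructor
  · intro h w hw
    have := h _ ⟨w, hw, rfl⟩
    rwa [map_sub, specialize_ofMatrix, map_one, sub_eq_zero] at this
  · rintro h _ ⟨w, hw, rfl⟩
    rw [map_sub, specialize_ofMatrix, map_one, h w hw, sub_self]

end Closed

theorem isClosedSubgroup_repGroup (hn : 1 ≤ n) (k : Type u) [Field k] :
    IsClosedSubgroup k fun (A : Type u) [CommRing A] [Algebra k A] => repGroup s hn A := by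
  refine ⟨repEquations s n k, fun A _ _ M => ?_⟩
  rw [forall_repEquations M.1]
  exact ⟨fun ⟨f, hf⟩ => by rw [hf, ofMatrix_repMatrix], fun h => ⟨_, h⟩⟩

theorem isClosedSubgroup_repGroupPlus (hn : 1 ≤ n) (k : Type u) [Field k] :
    IsClosedSubgroup k fun (A : Type u) [CommRing A] [Algebra k A] => repGroupPlus s hn A := by
  refine ⟨repEquations s n k ∪ letterEquations s n k, fun A _ _ M => ?_⟩
  simp only [Set.mem_union, or_imp, forall_and]
  rw [forall_repEquations M.1, forall_letterEquations M.1]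
  constructor
  · rintro ⟨f, hf', hf⟩
    rw [hf, ofMatrix_repMatrix]
    exact ⟨rfl, hf'⟩
  · exact fun h => ⟨_, h.2, h.1⟩

end TruncSeries

/-! ### Series truncated at length one -/

namespace TruncG

variable {s : ℕ} {R : Type*} [CommRing R]

/-- The letter `i` as a word of length one. -/
def letter (i : Fin s) : TruncWord s 1 := ⟨[i], le_rfl, le_rfl⟩

theorem exists_eq_letter (w : TruncWord s 1) : ∃ i, w = letter i := by
  obtain ⟨w, h⟩ := w
  obtain ⟨i, rfl⟩ := List.length_eq_one_iff.1 (le_antisymm h.2 h.1)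
  exact ⟨i, rfl⟩

/-- The diagonal matrix of the coefficients of a series truncated at length one. -/
noncomputable def toGL (f : TruncG s 1 R) : GL (Fin s) R :=
  Matrix.GeneralLinearGroup.mk'' (Matrix.diagonal fun i => f.1 (letter i)) (by
    rw [Matrix.det_diagonal, IsUnit.prod_univ_iff]
    exact fun i => f.2 _ rfl)

theorem coe_toGL (f : TruncG s 1 R) :
    (toGL f).1 = Matrix.diagonal fun i => f.1 (letter i) := rfl

theorem toGL_mem (f : TruncG s 1 R) : toGL f ∈ torusGroup s R :=
  ⟨fun i => (f.2 (letter i) rfl).unit, rfl⟩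

theorem coe_mul (f g : TruncG s 1 R) : (f * g).1 = f.1.box g.1 := rfl

theorem mul_apply_letter (f g : TruncG s 1 R) (i : Fin s) :
    (f * g).1 (letter i) = f.1 (letter i) * g.1 (letter i) := by
  rw [coe_mul]
  have h : (letter i).1.length = 1 := rfl
  exact TruncSeries.box_letter f.1 g.1 (letter i) h

theorem toGL_mul (f g : TruncG s 1 R) : toGL (f * g) = toGL f * toGL g := by
  refine Units.ext ?_
  rw [Units.val_mul, coe_toGL, coe_toGL, coe_toGL, Matrix.diagonal_mul_diagonal]
  simp only [mul_apply_letter]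

/-- The homomorphism from `(𝔊ˢ)₁(R)` to the torus. -/
noncomputable def toTorus : TruncG s 1 R →ₙ* torusGroup s R where
  toFun f := ⟨toGL f, toGL_mem f⟩
  map_mul' f g := Subtype.ext (toGL_mul f g)

theorem toTorus_bijective : Function.Bijective (toTorus : TruncG s 1 R →ₙ* torusGroup s R) := by
  constructor
  · intro f g h
    have h : (toGL f).1 = (toGL g).1 := congrArg (fun M : torusGroup s R => M.1.1) h
    rw [coe_toGL, coe_toGL] at h
    refine Subtype.ext (funext fun w => ?_)
    obtain ⟨i, rfl⟩ := exists_eq_letter w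
    exact congrFun (Matrix.diagonal_injective h) i
  · rintro ⟨M, t, ht⟩
    have hlen : ∀ w : TruncWord s 1, 0 < w.1.length := fun w => w.2.1
    refine ⟨⟨fun w => t (w.1.get ⟨0, hlen w⟩), fun w _ => Units.isUnit _⟩, ?_⟩
    exact Subtype.ext (Units.ext ht.symm)

/-- The isomorphism of `(𝔊ˢ)₁(R)` with the torus. -/
noncomputable def torusEquiv : TruncG s 1 R ≃* torusGroup s R :=
  MulEquiv.ofBijective toTorus toTorus_bijective

theorem coe_torusEquiv (f : TruncG s 1 R) :
    (torusEquiv f : GL (Fin s) R).1 = Matrix.diagonal fun i => f.1 (letter i) := rfl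

end TruncG

theorem mainTheorem2 (s n : ℕ) (hs : 1 ≤ s) (hn : 1 ≤ n) :
    ∃ N : ℕ, 1 ≤ N ∧ ∀ (k : Type u) [Field k],
      -- `(𝔊ˢ)ₙ` is isomorphic to a closed subgroup of `𝔹_N`
      (∃ H : ∀ (R : Type u) [CommRing R] [Algebra k R], Subgroup (GL (Fin N) R),
        IsClosedSubgroup k H ∧
        (∀ (R : Type u) [CommRing R] [Algebra k R], H R ≤ borelGroup N R) ∧
        ∃ ρ : ∀ (R : Type u) [CommRing R] [Algebra k R], TruncG s n R ≃* H R,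
          ∀ (R R' : Type u) [CommRing R] [Algebra k R] [CommRing R'] [Algebra k R']
            (φ : R →ₐ[k] R') (f : TruncG s n R),
            (ρ R' (f.map (φ : R →+* R')) : GL (Fin N) R') =
              Matrix.GeneralLinearGroup.map (φ : R →+* R') (ρ R f : GL (Fin N) R)) ∧
      -- `(𝔊ˢ₊)ₙ` is isomorphic to a closed subgroup of `𝕌_N`
      (∃ H : ∀ (R : Type u) [CommRing R] [Algebra k R], Subgroup (GL (Fin N) R),
        IsClosedSubgroup k H ∧
        (∀ (R : Type u) [CommRing R] [Algebra k R], H R ≤ unipotentGroup N R) ∧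
        ∃ ρ : ∀ (R : Type u) [CommRing R] [Algebra k R], TruncGPlus s n R ≃* H R,
          ∀ (R R' : Type u) [CommRing R] [Algebra k R] [CommRing R'] [Algebra k R']
            (φ : R →ₐ[k] R') (f : TruncGPlus s n R),
            (ρ R' (f.map (φ : R →+* R')) : GL (Fin N) R') =
              Matrix.GeneralLinearGroup.map (φ : R →+* R') (ρ R f : GL (Fin N) R)) ∧
      -- `(𝔊ˢ)₁` is isomorphic to the torus `𝕋_s`
      (∃ ρ : ∀ (R : Type u) [CommRing R] [Algebra k R], TruncG s 1 R ≃* torusGroup s R,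
        ∀ (R R' : Type u) [CommRing R] [Algebra k R] [CommRing R'] [Algebra k R']
          (φ : R →ₐ[k] R') (f : TruncG s 1 R),
          (ρ R' (f.map (φ : R →+* R')) : GL (Fin s) R') =
            Matrix.GeneralLinearGroup.map (φ : R →+* R') (ρ R f : GL (Fin s) R)) := by
  refine ⟨numMonomials s n, numMonomials_pos s n, fun k _ => ⟨?_, ?_, ?_⟩⟩
  · refine ⟨fun R _ _ => TruncSeries.repGroup s hn R, TruncSeries.isClosedSubgroup_repGroup hn k,
      fun R _ _ => TruncSeries.repGroup_le hn, fun R _ _ => TruncSeries.repEquiv hn, ?_⟩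
    intro R R' _ _ _ _ φ f
    exact Units.ext (TruncSeries.map_repMatrix (φ : R →+* R') f.1)
  · refine ⟨fun R _ _ => TruncSeries.repGroupPlus s hn R,
      TruncSeries.isClosedSubgroup_repGroupPlus hn k, fun R _ _ => TruncSeries.repGroupPlus_le hn,
      fun R _ _ => TruncSeries.repPlusEquiv hn, ?_⟩
    intro R R' _ _ _ _ φ f
    exact Units.ext (TruncSeries.map_repMatrix (φ : R →+* R') f.1)
  · refine ⟨fun R _ _ => TruncG.torusEquiv, ?_⟩
    intro R R' _ _ _ _ φ f
    refine Units.ext ?_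
    change (TruncG.torusEquiv (f.map (φ : R →+* R')) : GL (Fin s) R').1 =
      (TruncG.torusEquiv f : GL (Fin s) R).1.map φ
    rw [TruncG.coe_torusEquiv, TruncG.coe_torusEquiv, Matrix.diagonal_map (map_zero φ)]
    rfl
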